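/- **Conventions.** A *Lawvere theory* $\mathcal T$ is a category with objects the natural numbers ($n$ is written $A^n$) and small hom-sets, together with an identity-on-objects functor $I\colon\aleph_0^{op}\to\mathcal T$ which preserves finite products, where $\aleph_0$ is the category of finite cardinals and all functions. A morphism of Lawvere theories is an identity-on-objects functor commuting with the functors $I$; it is an equivalence if it is fully faithful. Morphisms $f\colon A^n\to A^{n'}$ and $g\colon A^m\to A^{m'}$ of $\mathcal T$ *commute* if $f^{m'}\circ g^{n}$ and $g^{n'}\circ f^{m}$ agree up to the canonical isomorphisms $(A^m)^n\cong(A^n)^m$ and $(A^{n'})^{m'}\cong(A^{m'})^{n'}$. The *centre* $\mathcal T^\bot$ is the Lawvere theory with the same objects as $\mathcal T$, whose morphisms are the morphisms of $\mathcal T$ that commute with every morphism of $\mathcal T$. $\mathrm{Mod}(\mathcal T,\mathbf{Set})$ is the category of finite-product-preserving functors $\mathcal T\to\mathbf{Set}$ and natural transformations; the forgetful functor sends $M$ to $M(A)$. Let $T$ be a monad on $\mathbf{Set}$ with its canonical strength $\tau_{X,Y}\colon X\times TY\to T(X\times Y)$, $\tau_{X,Y}(x,t)=T(y\mapsto(x,y))(t)$,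 and right strength $\tau'_{X,Y}\colon TX\times Y\to T(X\times Y)$. A *central cone* of $T$ at $X$ is a map $\iota\colon Z\to TX$ such that for every set $Y$ the maps $\mu\circ T\tau'\circ\tau$ and $\mu\circ T\tau\circ\tau'$ from $TX\times TY$ to $T(X\times Y)$ agree after precomposition with $\iota\times TY$. A central cone $(Z,\iota)$ at $X$ is terminal if every central cone at $X$ factors uniquely through $\iota$. $T$ is *centralisable* if it has a terminal central cone at every set $X$; its *centre* is a strong monad $Z$ with a morphism of strong monads $\iota\colon Z\Rightarrow T$ such that each $(ZX,\iota_X)$ is a terminal central cone at $X$. For a monad $Z$ on $\mathbf{Set}$ with Kleisli category $\mathbf{Set}_Z$, write $\mathfrak s\mathbf{Set}_Z^{op}$ for the Lawvere theory given by the opposite of the full subcategory of $\mathbf{Set}_Z$ on the finite cardinals. **Theorem.** Let $\mathcal T$ be a Lawvere theory. The forgetful functor $\mathrm{Mod}(\mathcal T,\mathbf{Set})\to\mathbf{Set}$ has a left adjoint. Let $T$ be the induced monad on $\mathbf{Set}$. Then: 1. $T$ is centralisable, and its centre $\iota\colon Z\Rightarrow T$ exists. 2. The centre $Z$ is a commutative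 and finitary monad (it preserves filtered colimits). 3. The Lawvere theory $\mathfrak s\mathbf{Set}_Z^{op}$ corresponding to $Z$ is equivalent to the centre $\mathcal T^\bot$, as a subtheory of $\mathcal T$: there are equivalences of Lawvere theories $\varphi\colon\mathfrak s\mathbf{Set}_T^{op}\to\mathcal T$ and $e\colon\mathfrak s\mathbf{Set}_Z^{op}\to\mathcal T^\bot$ such that the composite of $e$ with the inclusion $\mathcal T^\bot\subseteq\mathcal T$ equals the composite of $\varphi$ with the functor $\mathfrak s\mathbf{Set}_Z^{op}\to\mathfrak s\mathbf{Set}_T^{op}$ induced by $\iota$. In particular, the opposite of a skeleton of the full subcategory of $\mathbf{Set}_Z$ on the finite sets is equivalent, as a category, to $\mathcal T^\bot$. -/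

import Mathlib

open CategoryTheory CategoryTheory.Limits MonoidalCategory

universe u v w

/-! ## Strong monads, central cones, and the centre of a strong monad -/

section StrongMonads

variable {C : Type w} [Category.{v} C] [MonoidalCategory C]

/-- A (left) strength `τ_{X,Y} : X ⊗ T Y ⟶ T (X ⊗ Y)` on a monad `T`; a strong monad is a monad
together with a strength. -/
structure Strength (T : Monad C) where
  str : ∀ X Y : C, X ⊗ T.obj Y ⟶ T.obj (X ⊗ Y)
  natural : ∀ {X X' Y Y' : C} (f : X ⟶ X') (g : Y ⟶ Y'),
    (f ⊗ₘ T.map g) ≫ str X' Y' = str X Y ≫ T.map (f ⊗ₘ g)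
  leftUnitor : ∀ Y : C, str (𝟙_ C) Y ≫ T.map (λ_ Y).hom = (λ_ (T.obj Y)).hom
  associator : ∀ X Y Z : C,
    str (X ⊗ Y) Z ≫ T.map (α_ X Y Z).hom =
      (α_ X Y (T.obj Z)).hom ≫ X ◁ str Y Z ≫ str X (Y ⊗ Z)
  unit : ∀ X Y : C, X ◁ T.η.app Y ≫ str X Y = T.η.app (X ⊗ Y)
  mult : ∀ X Y : C,
    X ◁ T.μ.app Y ≫ str X Y = str X (T.obj Y) ≫ T.map (str X Y) ≫ T.μ.app (X ⊗ Y)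

/-- A morphism of monads is a morphism of strong monads if it commutes with the strengths. -/
def IsStrongMonadHom {S T : Monad C} (σ : Strength S) (τ : Strength T) (ι : S ⟶ T) : Prop :=
  ∀ X Y : C, σ.str X Y ≫ ι.app (X ⊗ Y) = X ◁ ι.app Y ≫ τ.str X Y

namespace Strength

variable [SymmetricCategory C] {T : Monad C} (τ : Strength T)

/-- The right strength `τ'_{X,Y} : T X ⊗ Y ⟶ T (X ⊗ Y)`. -/
def rightStr (X Y : C) : T.obj X ⊗ Y ⟶ T.obj (X ⊗ Y) :=
  (β_ (T.obj X) Y).hom ≫ τ.str Y X ≫ T.map (β_ Y X).hom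

/-- The composite `T X ⊗ T Y ⟶ T (X ⊗ Y)` which uses first `τ`, then `τ'`. -/
def leftDouble (X Y : C) : T.obj X ⊗ T.obj Y ⟶ T.obj (X ⊗ Y) :=
  τ.str (T.obj X) Y ≫ T.map (τ.rightStr X Y) ≫ T.μ.app (X ⊗ Y)

/-- The composite `T X ⊗ T Y ⟶ T (X ⊗ Y)` which uses first `τ'`, then `τ`. -/
def rightDouble (X Y : C) : T.obj X ⊗ T.obj Y ⟶ T.obj (X ⊗ Y) :=
  τ.rightStr X (T.obj Y) ≫ T.map (τ.str X Y) ≫ T.μ.app (X ⊗ Y)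

/-- The strong monad is commutative. -/
def IsCommutative : Prop :=
  ∀ X Y : C, τ.leftDouble X Y = τ.rightDouble X Y

/-- `(Z, ι)` is a central cone of the strong monad at `X`. -/
def IsCentralCone (X : C) {Z : C} (ι : Z ⟶ T.obj X) : Prop :=
  ∀ Y : C, ι ▷ T.obj Y ≫ τ.leftDouble X Y = ι ▷ T.obj Y ≫ τ.rightDouble X Y

/-- `(Z, ι)` is a terminal object of the category of central cones at `X`. -/
def IsTerminalCentralCone (X : C) {Z : C} (ι : Z ⟶ T.obj X) : Prop :=
  τ.IsCentralCone X ι ∧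
    ∀ {Z' : C} (ι' : Z' ⟶ T.obj X), τ.IsCentralCone X ι' → ∃! φ : Z' ⟶ Z, φ ≫ ι = ι'

/-- The strong monad is centralisable: it has a terminal central cone at every object. -/
def IsCentralisable : Prop :=
  ∀ X : C, ∃ (Z : C) (ι : Z ⟶ T.obj X), τ.IsTerminalCentralCone X ι

/-- The strong monad `(Z, σ)`, with the morphism `ι : Z ⟶ T`, is the centre of `(T, τ)`: the
morphism `ι` is one of strong monads and its components are the terminal central cones. -/
structure IsCentre {Z : Monad C} (σ : Strength Z) (ι : Z ⟶ T) : Prop where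
  strong : IsStrongMonadHom σ τ ι
  terminal : ∀ X : C, τ.IsTerminalCentralCone X (ι.app X)

end Strength

end StrongMonads

/-- The map `y ↦ (x, y)`. -/
def pairWith {X Y : Type u} (x : X) : Y ⟶ X ⊗ Y := TypeCat.ofHom fun y => (x, y)

/-- The canonical strength `(x, t) ↦ T (y ↦ (x, y)) t` of a monad `T` on the category of sets. -/
def setStrength (T : Monad (Type u)) : Strength T where
  str X Y := TypeCat.ofHom fun p => T.map (pairWith p.1) p.2
  natural {X X' Y Y'} f g := by
    ext p
    exact (Functor.map_comp_apply T.toFunctor g (pairWith (f p.1)) p.2).symm.trans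
      (Functor.map_comp_apply T.toFunctor (pairWith p.1) (f ⊗ₘ g) p.2)
  leftUnitor Y := by
    ext p
    exact (Functor.map_comp_apply T.toFunctor (pairWith p.1) (λ_ Y).hom p.2).symm.trans
      (congrArg (fun f : T.obj Y ⟶ T.obj Y => f p.2) (T.toFunctor.map_id Y))
  associator X Y Z := by
    ext p
    exact (Functor.map_comp_apply T.toFunctor (pairWith p.1) (α_ X Y Z).hom p.2).symm.trans
      (Functor.map_comp_apply T.toFunctor (pairWith p.1.2) (pairWith p.1.1) p.2)
  unit X Y := by
    ext p
    exact (NatTrans.naturality_apply T.η (pairWith p.1) p.2).symm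
  mult X Y := by
    ext p
    refine (NatTrans.naturality_apply T.μ (pairWith p.1) p.2).symm.trans ?_
    refine congrArg (T.μ.app (X ⊗ Y)) ?_
    refine Eq.trans ?_ (Functor.map_comp_apply T.toFunctor (pairWith p.1)
      (TypeCat.ofHom fun q : X ⊗ T.obj Y => T.map (pairWith q.1) q.2) p.2)
    rfl

/-! ## Lawvere theories -/

/-- A Lawvere theory: a category whose objects are the natural numbers (`n` stands for `A ^ n`),
with an identity-on-objects functor `base` from the opposite of the category of the finite
cardinals and all functions between them, which preserves finite products, i.e. which makes every
`n` the `n`-fold power of `1`, with the images of the elements `1 → n` as projections. -/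
structure LawvereTheory where
  Hom : ℕ → ℕ → Type u
  id : ∀ n, Hom n n
  comp : ∀ {l m n}, Hom l m → Hom m n → Hom l n
  id_comp : ∀ {m n} (f : Hom m n), comp (id m) f = f
  comp_id : ∀ {m n} (f : Hom m n), comp f (id n) = f
  assoc : ∀ {k l m n} (f : Hom k l) (g : Hom l m) (h : Hom m n),
    comp (comp f g) h = comp f (comp g h)
  base : ∀ {m n : ℕ}, (Fin m → Fin n) → Hom n m
  base_id : ∀ n, base (fun i : Fin n => i) = id n
  base_comp : ∀ {l m n : ℕ} (u : Fin l → Fin m) (v : Fin m → Fin n),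
    base (fun i => v (u i)) = comp (base v) (base u)
  isProduct : ∀ k n : ℕ, Function.Bijective
    fun (f : Hom k n) (i : Fin n) => comp f (base fun _ : Fin 1 => i)

namespace LawvereTheory

variable (T : LawvereTheory.{u})

/-- The objects of the theory, as a type which carries the category structure. -/
@[ext]
structure Obj (T : LawvereTheory.{u}) where
  arity : ℕ

instance : Category.{u} T.Obj where
  Hom X Y := T.Hom X.arity Y.arity
  id X := T.id X.arity
  comp f g := T.comp f g
  id_comp f := T.id_comp f
  comp_id f := T.comp_id f
  assoc f g h := T.assoc f g h

/-- The models of the theory in sets: the finite-product-preserving functors `T ⥤ Set`, with all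
natural transformations between them. -/
abbrev Model : Type (u + 1) :=
  ObjectProperty.FullSubcategory fun M : T.Obj ⥤ Type u => PreservesFiniteProducts M

/-- The forgetful functor `M ↦ M A` from the models to sets. -/
def forget : T.Model ⥤ Type u :=
  ObjectProperty.ι _ ⋙ (evaluation T.Obj (Type u)).obj ⟨1⟩

/-- A morphism of Lawvere theories: an identity-on-objects functor under the finite cardinals. -/
structure Morphism (S T : LawvereTheory.{u}) where
  map : ∀ {m n : ℕ}, S.Hom m n → T.Hom m n
  map_id : ∀ n, map (S.id n) = T.id n
  map_comp : ∀ {l m n : ℕ} (f : S.Hom l m) (g : S.Hom m n),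
    map (S.comp f g) = T.comp (map f) (map g)
  map_base : ∀ {m n : ℕ} (w : Fin m → Fin n), map (S.base w) = T.base w

/-- An equivalence of Lawvere theories is a fully faithful morphism (hence an isomorphism of
categories, as it is the identity on objects). -/
def Morphism.IsEquiv {S T : LawvereTheory.{u}} (φ : Morphism S T) : Prop :=
  ∀ m n : ℕ, Function.Bijective (φ.map : S.Hom m n → T.Hom m n)

section Powers

variable {T}

/-- The projection `A ^ n → A` with index `i`. -/
def proj {n : ℕ} (i : Fin n) : T.Hom n 1 := T.base fun _ => i

/-- The morphism `A ^ k → A ^ n` with given components. -/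
noncomputable def tuple {k n : ℕ} (a : Fin n → T.Hom k 1) : T.Hom k n :=
  (Equiv.ofBijective _ (T.isProduct k n)).symm a

theorem tuple_proj {k n : ℕ} (a : Fin n → T.Hom k 1) (i : Fin n) :
    T.comp (tuple a) (proj i) = a i :=
  congrFun ((Equiv.ofBijective _ (T.isProduct k n)).apply_symm_apply a) i

theorem hom_ext {k n : ℕ} {f g : T.Hom k n}
    (h : ∀ i, T.comp f (proj i) = T.comp g (proj i)) : f = g :=
  (T.isProduct k n).injective (funext h)

/-- The power `f ^ p : (A ^ n) ^ p → (A ^ n') ^ p` of `f : A ^ n → A ^ n'`. Here `(A ^ n) ^ p` is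
`A ^ (p * n)`, whose factors are indexed by the pairs in `Fin p × Fin n`. -/
noncomputable def pow (p : ℕ) {n n' : ℕ} (f : T.Hom n n') : T.Hom (p * n) (p * n') :=
  tuple fun r => T.comp (T.base fun j => finProdFinEquiv ((finProdFinEquiv.symm r).1, j))
    (T.comp f (proj (finProdFinEquiv.symm r).2))

/-- The canonical isomorphism `(A ^ n) ^ p ≅ (A ^ p) ^ n`. -/
def swap (p n : ℕ) : T.Hom (p * n) (n * p) :=
  T.base fun r => finProdFinEquiv (finProdFinEquiv.symm r).swap

/-- `f ⋆ g = f ^ m' ∘ g ^ n : (A ^ m) ^ n → (A ^ n') ^ m'`. -/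
noncomputable def star {n n' m m' : ℕ} (f : T.Hom n n') (g : T.Hom m m') :
    T.Hom (n * m) (m' * n') :=
  T.comp (pow n g) (T.comp (swap n m') (pow m' f))

/-- `f` and `g` commute: `f ⋆ g` and `g ⋆ f` agree, up to the canonical isomorphisms
`(A ^ m) ^ n ≅ (A ^ n) ^ m` and `(A ^ n') ^ m' ≅ (A ^ m') ^ n'`. -/
def Commute {n n' m m' : ℕ} (f : T.Hom n n') (g : T.Hom m m') : Prop :=
  T.comp (star f g) (swap m' n') = T.comp (swap n m) (star g f)

/-- `f` commutes with all morphisms of the theory. -/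
def IsCentral {n n' : ℕ} (f : T.Hom n n') : Prop :=
  ∀ (m m' : ℕ) (g : T.Hom m m'), Commute f g

/-- The operation on generalised elements given by a morphism of the theory. -/
noncomputable def act {k n n' : ℕ} (f : T.Hom n n') (a : Fin n → T.Hom k 1) (j : Fin n') :
    T.Hom k 1 :=
  T.comp (tuple a) (T.comp f (proj j))

theorem base_proj {m n : ℕ} (w : Fin m → Fin n) (i : Fin m) :
    T.comp (T.base w) (proj i) = proj (w i) :=
  (T.base_comp (fun _ : Fin 1 => i) w).symm

theorem tuple_coords {k n : ℕ} (h : T.Hom k n) : tuple (fun i => T.comp h (proj i)) = h :=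
  hom_ext fun i => tuple_proj _ i

theorem comp_comp_proj {k n n' : ℕ} (h : T.Hom k n) (f : T.Hom n n') (j : Fin n') :
    T.comp (T.comp h f) (proj j) = act f (fun i => T.comp h (proj i)) j := by
  rw [act, tuple_coords, T.assoc]

theorem act_comp {k n n' n'' : ℕ} (f : T.Hom n n') (f' : T.Hom n' n'')
    (a : Fin n → T.Hom k 1) (j : Fin n'') : act (T.comp f f') a j = act f' (act f a) j := by
  have h : tuple (act f a) = T.comp (tuple a) f := hom_ext fun i => by
    rw [tuple_proj, act, T.assoc]
  rw [act, act, h, T.assoc, T.assoc]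

theorem act_base {k m n : ℕ} (w : Fin m → Fin n) (a : Fin n → T.Hom k 1) (i : Fin m) :
    act (T.base w) a i = a (w i) := by
  rw [act, base_proj, tuple_proj]

theorem act_comp_proj {k n n' : ℕ} (f : T.Hom n n') (a : Fin n → T.Hom k 1) (j : Fin n')
    (i : Fin 1) : act (T.comp f (proj j)) a i = act f a j := by
  rw [act_comp]
  exact act_base _ _ _

theorem act_pow {k p n n' : ℕ} (f : T.Hom n n') (a : Fin (p * n) → T.Hom k 1)
    (r : Fin p) (j : Fin n') :
    act (pow p f) a (finProdFinEquiv (r, j)) =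
      act f (fun i => a (finProdFinEquiv (r, i))) j := by
  have e : tuple (fun i => a (finProdFinEquiv (r, i))) =
      T.comp (tuple a) (T.base fun i => finProdFinEquiv (r, i)) := hom_ext fun i => by
    rw [tuple_proj, T.assoc, base_proj, tuple_proj]
  rw [act, pow, tuple_proj, act, e, T.assoc, Equiv.symm_apply_apply]

theorem act_swap {k p n : ℕ} (a : Fin (p * n) → T.Hom k 1) (i : Fin n) (r : Fin p) :
    act (swap p n) a (finProdFinEquiv (i, r)) = a (finProdFinEquiv (r, i)) := by
  rw [swap, act_base, Equiv.symm_apply_apply, Prod.swap_prod_mk]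

/-- Commutation in terms of generalised elements: `f` and `g` may be applied to the columns and to
the rows of a matrix in either order. -/
theorem commute_iff {n n' m m' : ℕ} (f : T.Hom n n') (g : T.Hom m m') :
    Commute f g ↔ ∀ (k : ℕ) (a : Fin n → Fin m → T.Hom k 1) (j : Fin n') (i : Fin m'),
      act f (fun s => act g (a s) i) j = act g (fun t => act f (fun s => a s t) j) i := by
  have key : ∀ (k : ℕ) (a : Fin (n * m) → T.Hom k 1) (j : Fin n') (i : Fin m'),
      act (T.comp (star f g) (swap m' n')) a (finProdFinEquiv (j, i)) =
        act f (fun s => act g (fun t => a (finProdFinEquiv (s, t))) i) j ∧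
      act (T.comp (swap n m) (star g f)) a (finProdFinEquiv (j, i)) =
        act g (fun t => act f (fun s => a (finProdFinEquiv (s, t))) j) i := by
    intro k a j i
    simp only [star, act_comp, act_swap, act_pow, and_self]
  constructor
  · intro h k a j i
    have := key k (fun r => a (finProdFinEquiv.symm r).1 (finProdFinEquiv.symm r).2) j i
    rw [h] at this
    simpa using this.1.symm.trans this.2
  · intro h
    refine hom_ext fun r => ?_
    obtain ⟨⟨j, i⟩, rfl⟩ := finProdFinEquiv.surjective r
    have e : ∀ q : T.Hom (n * m) (n' * m'), T.comp q (proj (finProdFinEquiv (j, i))) =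
        act q (fun s => proj s) (finProdFinEquiv (j, i)) := fun q => by
      rw [← T.id_comp q, comp_comp_proj]
      simp only [T.id_comp]
    rw [e, e, (key _ _ j i).1, (key _ _ j i).2]
    exact h _ (fun s t => proj (finProdFinEquiv (s, t))) j i

theorem isCentral_base {m n : ℕ} (w : Fin m → Fin n) : IsCentral (T.base w) := fun _ _ g => by
  rw [commute_iff]
  intro k a j i
  simp only [act_base]

theorem IsCentral.comp {l m n : ℕ} {f : T.Hom l m} {g : T.Hom m n} (hf : IsCentral f)
    (hg : IsCentral g) : IsCentral (T.comp f g) := fun p p' h => by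
  rw [commute_iff]
  intro k a j i
  rw [act_comp]
  have e : act f (fun s => act h (a s) i) =
      fun j' => act h (fun t => act f (fun s => a s t) j') i :=
    funext fun j' => (commute_iff f h).1 (hf p p' h) k a j' i
  rw [e, (commute_iff g h).1 (hg p p' h) k (fun j' t => act f (fun s => a s t) j') j i]
  simp only [act_comp]

theorem isCentral_of_proj {k n : ℕ} {f : T.Hom k n}
    (h : ∀ i, IsCentral (T.comp f (proj i))) : IsCentral f := fun m m' g => by
  rw [commute_iff]
  intro l a j i
  have := (commute_iff _ g).1 (h j m m' g) l a 0 i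
  simpa only [act_comp_proj] using this

end Powers

/-- The centre `T^⊥` of the theory: the same objects, and those morphisms which commute with all
morphisms of the theory. -/
def centre : LawvereTheory.{u} where
  Hom m n := { f : T.Hom m n // IsCentral f }
  id n := ⟨T.id n, T.base_id n ▸ isCentral_base _⟩
  comp f g := ⟨T.comp f.1 g.1, f.2.comp g.2⟩
  id_comp f := Subtype.ext (T.id_comp f.1)
  comp_id f := Subtype.ext (T.comp_id f.1)
  assoc f g h := Subtype.ext (T.assoc f.1 g.1 h.1)
  base w := ⟨T.base w, isCentral_base w⟩
  base_id n := Subtype.ext (T.base_id n)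
  base_comp w w' := Subtype.ext (T.base_comp w w')
  isProduct k n := by
    refine ⟨fun f g h => Subtype.ext (hom_ext fun i => ?_), fun a => ?_⟩
    · exact congrArg Subtype.val (congrFun h i)
    · refine ⟨⟨tuple fun i => (a i).1, isCentral_of_proj fun i => ?_⟩, funext fun i => ?_⟩
      · rw [tuple_proj]
        exact (a i).2
      · exact Subtype.ext (tuple_proj _ i)

/-- The inclusion of the centre. -/
def centreInclusion : Morphism T.centre T where
  map f := f.1
  map_id _ := rfl
  map_comp _ _ := rfl
  map_base _ := rfl

end LawvereTheory

/-! ## The Lawvere theory of a monad on sets -/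

section Kleisli

/-- The finite cardinal `n`, as an object of the Kleisli category. -/
abbrev kleisliFin (Z : Monad (Type u)) (n : ℕ) : Kleisli Z := Kleisli.mk Z (ULift.{u} (Fin n))

/-- The full subcategory of the Kleisli category on the finite sets. -/
abbrev FiniteKleisli (Z : Monad (Type u)) : Type (u + 1) :=
  ObjectProperty.FullSubcategory fun X : Kleisli Z => Finite X.of

/-- The map of finite cardinals given by a function between their underlying sets. -/
def finMap {m n : ℕ} (w : Fin m → Fin n) : ULift.{u} (Fin m) ⟶ ULift.{u} (Fin n) :=
  TypeCat.ofHom fun i => ULift.up (w i.down)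

/-- The map of finite cardinals given by a function, as a morphism of the Kleisli category. -/
def kleisliBase (Z : Monad (Type u)) {m n : ℕ} (w : Fin m → Fin n) :
    kleisliFin Z m ⟶ kleisliFin Z n :=
  Kleisli.Hom.mk (finMap w ≫ Z.η.app (ULift.{u} (Fin n)))

theorem kleisliBase_comp {Z : Monad (Type u)} {m n k : ℕ} (w : Fin m → Fin n)
    (f : kleisliFin Z n ⟶ kleisliFin Z k) :
    kleisliBase Z w ≫ f = Kleisli.Hom.mk (finMap w ≫ f.of) := Kleisli.hom_ext <| by
  change (finMap w ≫ Z.η.app _) ≫ Z.map f.of ≫ Z.μ.app _ = finMap w ≫ f.of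
  have h : Z.η.app _ ≫ Z.map f.of = f.of ≫ Z.η.app _ := (Z.η.naturality f.of).symm
  rw [Category.assoc, reassoc_of% h, Z.left_unit]
  rfl

/-- The Lawvere theory of a monad `Z` on sets: the opposite of the full subcategory of the Kleisli
category on the finite cardinals. -/
def kleisliTheory (Z : Monad (Type u)) : LawvereTheory.{u} where
  Hom m n := kleisliFin Z n ⟶ kleisliFin Z m
  id n := 𝟙 (kleisliFin Z n)
  comp f g := g ≫ f
  id_comp f := Category.comp_id f
  comp_id f := Category.id_comp f
  assoc f g h := (Category.assoc h g f).symm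
  base w := kleisliBase Z w
  base_id n := (Kleisli.Adjunction.toKleisli Z).map_id _
  base_comp w w' := (Kleisli.Adjunction.toKleisli Z).map_comp (finMap w) (finMap w')
  isProduct k n := by
    refine ⟨fun f g h => Kleisli.hom_ext ?_, fun a => ?_⟩
    · ext i
      have := congrArg Kleisli.Hom.of ((kleisliBase_comp _ f).symm.trans
        ((congrFun h i.down).trans (kleisliBase_comp _ g)))
      exact congrArg (fun q : ULift.{u} (Fin 1) ⟶ Z.obj (ULift.{u} (Fin k)) => q ⟨0⟩) this
    · refine ⟨Kleisli.Hom.mk (TypeCat.ofHom fun i => (a i.down).of ⟨0⟩), funext fun i =>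
        (kleisliBase_comp _ _).trans (Kleisli.hom_ext ?_)⟩
      ext ⟨j⟩
      rw [Subsingleton.elim j 0]
      rfl

/-- The morphism of Lawvere theories, `f ↦ ι ∘ f` on Kleisli morphisms, induced by a morphism of
monads `ι`. -/
def kleisliTheoryMap {Z T : Monad (Type u)} (ι : Z ⟶ T) :
    LawvereTheory.Morphism (kleisliTheory Z) (kleisliTheory T) where
  map {m n} (f : kleisliFin Z n ⟶ kleisliFin Z m) := Kleisli.Hom.mk (f.of ≫ ι.app _)
  map_id n := Kleisli.hom_ext (ι.app_η _)
  map_comp {l m n} (f : kleisliFin Z m ⟶ kleisliFin Z l)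
      (g : kleisliFin Z n ⟶ kleisliFin Z m) := Kleisli.hom_ext <| by
    change (g.of ≫ Z.map f.of ≫ Z.μ.app _) ≫ ι.app _ =
      (g.of ≫ ι.app _) ≫ T.map (f.of ≫ ι.app _) ≫ T.μ.app _
    simp
  map_base w := Kleisli.hom_ext <| by
    change (finMap w ≫ Z.η.app _) ≫ ι.app _ = finMap w ≫ T.η.app _
    rw [Category.assoc, ι.app_η]

end Kleisli

/-! On sets, being a central cone is a pointwise condition: `κ : Z ⟶ T X` is central iff every value
of `κ` is a central element, one that may be exchanged with every `s : T Y` in a double Kleisli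
extension (`isCentralCone_iff`). The terminal central cone at `X` is therefore the inclusion of the
set of central elements of `T X`. Units are central and central elements are closed under Kleisli
extension, so these sets form a submonad, which is the centre.

The remaining claims are proved for an arbitrary centre `ι : Z ⟶ T`. Its components are mono, and
`ι` carries both double strengths of `Z` to those of `T`, where the cone condition identifies them;
hence `Z` is commutative. Elements of free models are terms with finitely many variables, so every
element of `T X` comes from a finite set. This passes to `Z` along a retraction of `X` onto a finite
subset, and it implies preservation of filtered colimits.

For the comparison of theories, the model represented by `A ^ n` is free on `n` generators, so
elements of `T n` are morphisms `A ^ n → A` (`toHom`, `ofHom`) and Kleisli extension is composition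
(`toHom_bind`). Central elements match central morphisms: any `s : T Y` is one operation applied to
finitely many generators, so commutation with morphisms of the theory suffices
(`isCentralElement_op_gen`); conversely, commutation of morphisms can be tested on matrices of
elements of `T k` (`isCentral_toHom`). Morphisms into `A ^ n` are handled componentwise. The left
adjoint is built from terms modulo equality in all models. -/

/-! ## The centre of a strong monad is commutative -/

section CentreCommutative

variable {C : Type w} [Category.{v} C] [MonoidalCategory C] [SymmetricCategory C]

namespace Strength

variable {S T : Monad C} {σ : Strength S} {τ : Strength T} {ι : S ⟶ T}

theorem rightStr_comp (h : IsStrongMonadHom σ τ ι) (X Y : C) :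
    σ.rightStr X Y ≫ ι.app (X ⊗ Y) = ι.app X ▷ Y ≫ τ.rightStr X Y := by
  rw [rightStr, rightStr, Category.assoc, Category.assoc, ι.naturality, ← Category.assoc (σ.str _ _),
    h, BraidedCategory.braiding_naturality_left_assoc, Category.assoc]

/-- The whiskering of `ι.app X` is placed last before the double strength of `T`, which is where the
central cone condition applies. -/
theorem leftDouble_comp (h : IsStrongMonadHom σ τ ι) (X Y : C) :
    σ.leftDouble X Y ≫ ι.app (X ⊗ Y) =
      S.obj X ◁ ι.app Y ≫ ι.app X ▷ T.obj Y ≫ τ.leftDouble X Y := by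
  have e := τ.natural (ι.app X) (𝟙 Y)
  simp only [CategoryTheory.Functor.map_id, tensorHom_id] at e
  calc σ.leftDouble X Y ≫ ι.app (X ⊗ Y)
      = σ.str _ _ ≫ S.map (σ.rightStr X Y ≫ ι.app _) ≫ ι.app _ ≫ T.μ.app _ := by
        simp [leftDouble, ι.app_μ]
    _ = (σ.str _ _ ≫ ι.app _) ≫ T.map (ι.app X ▷ Y) ≫ T.map (τ.rightStr X Y) ≫ T.μ.app _ := by
        rw [rightStr_comp h, ι.naturality_assoc]
        simp
    _ = _ := by
        rw [h, Category.assoc, ← reassoc_of% e]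
        rfl

theorem rightDouble_comp (h : IsStrongMonadHom σ τ ι) (X Y : C) :
    σ.rightDouble X Y ≫ ι.app (X ⊗ Y) =
      S.obj X ◁ ι.app Y ≫ ι.app X ▷ T.obj Y ≫ τ.rightDouble X Y := by
  have e : τ.rightStr X (S.obj Y) ≫ T.map (X ◁ ι.app Y) =
      T.obj X ◁ ι.app Y ≫ τ.rightStr X (T.obj Y) := by
    have := τ.natural (ι.app Y) (𝟙 X)
    simp only [CategoryTheory.Functor.map_id, tensorHom_id] at this
    rw [rightStr, rightStr, BraidedCategory.braiding_naturality_right_assoc, reassoc_of% this]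
    simp only [Category.assoc, ← T.map_comp, BraidedCategory.braiding_naturality_left]
  calc σ.rightDouble X Y ≫ ι.app (X ⊗ Y)
      = σ.rightStr _ _ ≫ S.map (σ.str X Y ≫ ι.app _) ≫ ι.app _ ≫ T.μ.app _ := by
        simp [rightDouble, ι.app_μ]
    _ = (σ.rightStr _ _ ≫ ι.app _) ≫ T.map (X ◁ ι.app Y) ≫ T.map (τ.str X Y) ≫ T.μ.app _ := by
        rw [h, ι.naturality_assoc]
        simp
    _ = _ := by
        rw [rightStr_comp h, Category.assoc, reassoc_of% e, whisker_exchange_assoc]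
        rfl

theorem IsCentralCone.precomp {X Z Z' : C} {κ : Z ⟶ T.obj X} (h : τ.IsCentralCone X κ)
    (f : Z' ⟶ Z) : τ.IsCentralCone X (f ≫ κ) := fun Y => by
  rw [comp_whiskerRight, Category.assoc, Category.assoc, h Y]

theorem IsTerminalCentralCone.mono {X Z : C} {κ : Z ⟶ T.obj X}
    (h : τ.IsTerminalCentralCone X κ) : Mono κ :=
  ⟨fun f _ e => (h.2 _ (h.1.precomp f)).unique rfl e.symm⟩

/-- Since `ι.app (X ⊗ Y)` is mono, the comparison can be made in `T`, where it is the cone condition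
for `ι.app X`. -/
theorem IsCentre.isCommutative (h : τ.IsCentre σ ι) : σ.IsCommutative := fun X Y => by
  have := (h.terminal (X ⊗ Y)).mono
  rw [← cancel_mono (ι.app (X ⊗ Y)), leftDouble_comp h.strong, rightDouble_comp h.strong,
    (h.terminal X).1 Y]

end Strength

end CentreCommutative

/-! ## The centre of a monad on sets -/

section SetMonad

namespace CategoryTheory.Monad

/-! ### Kleisli calculus and central elements of a monad on sets. -/

variable (T : Monad (Type u))

/-- The unit of a monad on sets, as a function. -/
def ret {X : Type u} (x : X) : T.obj X := T.η.app X x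

/-- The Kleisli extension of a monad on sets, as a function. -/
def bind {X Y : Type u} (t : T.obj X) (h : X → T.obj Y) : T.obj Y :=
  T.μ.app Y (T.map (TypeCat.ofHom h) t)

variable {T}

theorem map_apply_eq_bind {X Y : Type u} (f : X ⟶ Y) (t : T.obj X) :
    T.map f t = T.bind t fun x => T.ret (f x) := by
  have h : (TypeCat.ofHom fun x => T.ret (f x) : X ⟶ T.obj Y) = f ≫ T.η.app Y := rfl
  rw [bind, h, T.map_comp, ← ConcreteCategory.comp_apply, Category.assoc, T.right_unit]
  rfl

theorem mu_apply_eq_bind {X : Type u} (t : T.obj (T.obj X)) :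
    T.μ.app X t = T.bind t fun s => s := by
  have h : (TypeCat.ofHom fun s : T.obj X => s : T.obj X ⟶ T.obj X) = 𝟙 _ := rfl
  rw [bind, h, T.map_id]
  rfl

theorem ret_bind {X Y : Type u} (x : X) (h : X → T.obj Y) : T.bind (T.ret x) h = h x := by
  have e := NatTrans.naturality_apply T.η (TypeCat.ofHom h) x
  have := congrArg (fun f => f (h x)) (T.left_unit Y)
  exact (congrArg (T.μ.app Y) e.symm).trans this

theorem bind_ret {X : Type u} (t : T.obj X) : (T.bind t fun x => T.ret x) = t :=
  (map_apply_eq_bind (𝟙 X) t).symm.trans (congrArg (fun f => f t) (T.map_id X))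

theorem bind_assoc {X Y W : Type u} (t : T.obj X) (h : X → T.obj Y) (k : Y → T.obj W) :
    T.bind (T.bind t h) k = T.bind t fun x => T.bind (h x) k := by
  have e := NatTrans.naturality_apply T.μ (TypeCat.ofHom k) (T.map (TypeCat.ofHom h) t)
  have a := congrArg (fun f => f (T.map (T.map (TypeCat.ofHom k)) (T.map (TypeCat.ofHom h) t)))
    (T.assoc W)
  have c : T.map (TypeCat.ofHom fun x => T.bind (h x) k) t =
      T.map (T.μ.app W) (T.map (T.map (TypeCat.ofHom k)) (T.map (TypeCat.ofHom h) t)) := by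
    simp only [← ConcreteCategory.comp_apply, ← T.map_comp]
    rfl
  exact (congrArg (T.μ.app W) e.symm).trans (a.symm.trans (congrArg (T.μ.app W) c.symm))

theorem map_bind {X Y W : Type u} (f : X ⟶ Y) (t : T.obj X) (h : Y → T.obj W) :
    T.bind (T.map f t) h = T.bind t fun x => h (f x) := by
  simp only [map_apply_eq_bind, bind_assoc, ret_bind]

theorem setStrength_str_apply {X Y : Type u} (x : X) (s : T.obj Y) :
    (setStrength T).str X Y (x, s) = T.bind s fun y => T.ret ((x, y) : X ⊗ Y) :=
  map_apply_eq_bind _ _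

theorem setStrength_rightStr_apply {X Y : Type u} (t : T.obj X) (y : Y) :
    (setStrength T).rightStr X Y (t, y) = T.bind t fun x => T.ret ((x, y) : X ⊗ Y) := by
  refine (map_apply_eq_bind _ _).trans ?_
  refine (congrArg (fun q => T.bind q _) (setStrength_str_apply y t)).trans ?_
  simp only [bind_assoc, ret_bind]
  rfl

theorem setStrength_leftDouble_apply {X Y : Type u} (t : T.obj X) (s : T.obj Y) :
    (setStrength T).leftDouble X Y (t, s) =
      T.bind s fun y => T.bind t fun x => T.ret ((x, y) : X ⊗ Y) := by
  refine (mu_apply_eq_bind _).trans ?_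
  refine (map_bind _ _ _).trans ?_
  refine (congrArg (fun q => T.bind q _) (setStrength_str_apply t s)).trans ?_
  simp only [bind_assoc, ret_bind, setStrength_rightStr_apply]

theorem setStrength_rightDouble_apply {X Y : Type u} (t : T.obj X) (s : T.obj Y) :
    (setStrength T).rightDouble X Y (t, s) =
      T.bind t fun x => T.bind s fun y => T.ret ((x, y) : X ⊗ Y) := by
  refine (mu_apply_eq_bind _).trans ?_
  refine (map_bind _ _ _).trans ?_
  refine (congrArg (fun q => T.bind q _) (setStrength_rightStr_apply t s)).trans ?_
  simp only [bind_assoc, ret_bind, setStrength_str_apply]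

/-- The element `t : T X` commutes with all elements of all `T Y`. -/
def IsCentralElement {X : Type u} (t : T.obj X) : Prop :=
  ∀ (Y : Type u) (s : T.obj Y),
    (T.bind s fun y => T.bind t fun x => T.ret ((x, y) : X × Y)) =
      T.bind t fun x => T.bind s fun y => T.ret ((x, y) : X × Y)

theorem isCentralCone_iff {X Z : Type u} (κ : Z ⟶ T.obj X) :
    (setStrength T).IsCentralCone X κ ↔ ∀ z, IsCentralElement (κ z) := by
  constructor
  · intro h z Y s
    have := congrArg (fun f => f (z, s)) (h Y)
    exact (setStrength_leftDouble_apply (κ z) s).symm.trans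
      (this.trans (setStrength_rightDouble_apply (κ z) s))
  · intro h Y
    ext ⟨z, s⟩
    exact (setStrength_leftDouble_apply (κ z) s).trans
      ((h z Y s).trans (setStrength_rightDouble_apply (κ z) s).symm)

/-- Pairing is the universal case: extending the defining identity along `k` gives every other one.
-/
theorem IsCentralElement.bind_comm {X Y W : Type u} {t : T.obj X} (ht : IsCentralElement t)
    (s : T.obj Y) (k : X → Y → T.obj W) :
    (T.bind s fun y => T.bind t fun x => k x y) = T.bind t fun x => T.bind s fun y => k x y := by
  have := congrArg (fun q => T.bind q fun p => k p.1 p.2) (ht Y s)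
  simpa only [bind_assoc, ret_bind] using this

theorem isCentralElement_ret {X : Type u} (x : X) : IsCentralElement (T.ret x) := fun Y s => by
  simp only [ret_bind]

/-- An element `s` is moved past `t` and then past each `h x`. -/
theorem IsCentralElement.bind {X Y : Type u} {t : T.obj X} (ht : IsCentralElement t)
    {h : X → T.obj Y} (hh : ∀ x, IsCentralElement (h x)) : IsCentralElement (T.bind t h) :=
  fun W s => by
    simp only [bind_assoc]
    rw [ht.bind_comm]
    exact congrArg _ (funext fun x => hh x W s)

theorem IsCentralElement.map {X Y : Type u} {t : T.obj X} (ht : IsCentralElement t)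
    (f : X ⟶ Y) : IsCentralElement (T.map f t) := by
  rw [map_apply_eq_bind]
  exact ht.bind fun x => isCentralElement_ret _

variable (T)

/-- The submonad of the central elements of a monad on sets. -/
def centralElements : Monad (Type u) where
  obj X := { t : T.obj X // IsCentralElement t }
  map f := TypeCat.ofHom fun t => ⟨T.map f t.1, t.2.map f⟩
  map_id X := by
    ext t
    exact congrArg (fun f => f t.1) (T.map_id X)
  map_comp f g := by
    ext t
    exact congrArg (fun f => f t.1) (T.map_comp f g)
  η :=
    { app := fun X => TypeCat.ofHom fun x => ⟨T.ret x, isCentralElement_ret x⟩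
      naturality := fun X Y f => by
        ext x
        exact NatTrans.naturality_apply T.η f x }
  μ :=
    { app := fun X => TypeCat.ofHom fun t => ⟨T.bind t.1 fun s => s.1, t.2.bind fun s => s.2⟩
      naturality := fun X Y f => by
        ext t
        refine (map_bind _ t.1 _).trans ?_
        refine Eq.trans ?_ (map_apply_eq_bind f (T.bind t.1 fun s => s.1)).symm
        rw [bind_assoc]
        exact congrArg _ (funext fun s => map_apply_eq_bind f s.1) }
  assoc X := by
    ext t
    refine (map_bind _ t.1 _).trans ?_
    exact (bind_assoc t.1 (fun s => s.1) fun s => s.1).symm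
  left_unit X := by
    ext t
    exact ret_bind t fun s => s.1
  right_unit X := by
    ext t
    exact (map_bind _ t.1 _).trans (bind_ret t.1)

/-- The inclusion of the submonad of the central elements. -/
def centralElementsInclusion : T.centralElements ⟶ T where
  app X := TypeCat.ofHom fun t => t.1
  naturality _ _ _ := rfl
  app_η _ := rfl
  app_μ X := by
    ext t
    refine Eq.trans ?_ (mu_apply_eq_bind _).symm
    exact (map_bind (TypeCat.ofHom Subtype.val) t.1 fun s => s).symm

theorem isCentre_centralElements :
    (setStrength T).IsCentre (setStrength T.centralElements) T.centralElementsInclusion where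
  strong X Y := by
    ext p
    rfl
  terminal X := by
    refine ⟨(isCentralCone_iff _).2 fun z => z.2, fun {Z'} κ h => ?_⟩
    refine ⟨TypeCat.ofHom fun z => ⟨κ z, (isCentralCone_iff κ).1 h z⟩, rfl, fun φ hφ => ?_⟩
    subst hφ
    rfl

variable {T}

/-- A central element is a central cone with a one-point vertex, so it factors through any terminal
cone. This makes an arbitrary centre as usable as the explicit one. -/
theorem isCentralElement_iff_mem_range {X Z : Type u} {κ : Z ⟶ T.obj X}
    (h : (setStrength T).IsTerminalCentralCone X κ) (t : T.obj X) :
    IsCentralElement t ↔ t ∈ Set.range κ := by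
  constructor
  · intro ht
    obtain ⟨φ, hφ, -⟩ := h.2 (TypeCat.ofHom fun _ : PUnit.{u + 1} => t)
      ((isCentralCone_iff _).2 fun _ => ht)
    exact ⟨φ PUnit.unit, congrArg (fun f => f PUnit.unit) hφ⟩
  · rintro ⟨z, rfl⟩
    exact (isCentralCone_iff κ).1 h.1 z

theorem injective_of_isTerminalCentralCone {X Z : Type u} {κ : Z ⟶ T.obj X}
    (h : (setStrength T).IsTerminalCentralCone X κ) : Function.Injective κ :=
  (mono_iff_injective κ).1 h.mono

end CategoryTheory.Monad

end SetMonad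

/-! ## Finitary endofunctors of the category of sets -/

section Finitary

/-- Every element of every `H X` comes from a map of a finite set into `X`. -/
def FinitelySupported (H : Type u ⥤ Type u) : Prop :=
  ∀ (X : Type u) (t : H.obj X), ∃ (A : Type u) (_ : Finite A) (i : A ⟶ X) (a : H.obj A),
    H.map i a = t

variable {J : Type u} [Category.{u} J] [IsFiltered J] {K : J ⥤ Type u} {c : Cocone K}

theorem exists_lift_of_finite (hc : IsColimit c) {A : Type u} [Finite A] (x : A → c.pt) :
    ∃ (j : J) (y : A → K.obj j), ∀ a, c.ι.app j (y a) = x a := by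
  classical
  have := Fintype.ofFinite A
  choose j y hy using fun a => Types.jointly_surjective_of_isColimit hc (x a)
  obtain ⟨k, hk⟩ := IsFiltered.sup_objs_exists (Finset.univ.image j)
  have f : ∀ a, j a ⟶ k := fun a =>
    (hk (Finset.mem_image_of_mem j (Finset.mem_univ a))).some
  refine ⟨k, fun a => K.map (f a) (y a), fun a => ?_⟩
  rw [← hy a, ← c.w (f a)]
  rfl

theorem exists_map_eq_of_finite (hc : IsColimit c) {A : Type u} [Finite A] {j : J}
    (x y : A → K.obj j) (h : ∀ a, c.ι.app j (x a) = c.ι.app j (y a)) :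
    ∃ (k : J) (f : j ⟶ k), ∀ a, K.map f (x a) = K.map f (y a) := by
  classical
  have := Fintype.ofFinite A
  choose k f hf using fun a => (Types.FilteredColimit.isColimit_eq_iff' hc (x a) (y a)).1 (h a)
  -- The pairs are merged one at a time; `IsFiltered.span` completes the old and the new arrow out
  -- of `j` to a commutative square.
  have key : ∀ s : Finset A, ∃ (l : J) (g : j ⟶ l), ∀ a ∈ s, K.map g (x a) = K.map g (y a) := by
    intro s
    induction s using Finset.induction_on with
    | empty => exact ⟨j, 𝟙 j, by simp⟩
    | insert a s _ ih =>
      obtain ⟨l, g, hg⟩ := ih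
      obtain ⟨m, p, q, hpq⟩ := IsFiltered.span g (f a)
      refine ⟨m, g ≫ p, fun b hb => ?_⟩
      rcases Finset.mem_insert.1 hb with rfl | hb
      · rw [hpq, K.map_comp]
        exact congrArg (K.map q) (hf b)
      · rw [K.map_comp]
        exact congrArg (K.map p) (hg b hb)
  obtain ⟨l, g, hg⟩ := key Finset.univ
  exact ⟨l, g, fun a => hg a (Finset.mem_univ a)⟩

/-- Surjectivity: a finite support in the colimit lifts to some stage. Injectivity: if two elements
at stage `j` agree in `H c.pt`, some map `r : c.pt → K.obj k` satisfies `r ∘ c.ι.app j = K.map f` on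
both finite supports, and applying `H r` brings the equality back to stage `k`. -/
theorem FinitelySupported.preservesFilteredColimits {H : Type u ⥤ Type u}
    (hH : FinitelySupported H) : PreservesFilteredColimits H := by
  refine ⟨fun J _ _ => ⟨fun {K} => ⟨fun {c} hc => ⟨?_⟩⟩⟩⟩
  have inj : ∀ (j : J) (a b : H.obj (K.obj j)),
      H.map (c.ι.app j) a = H.map (c.ι.app j) b →
        ∃ (k : J) (f : j ⟶ k), H.map (K.map f) a = H.map (K.map f) b := by
    intro j a b hab
    obtain ⟨A, _, x, a', rfl⟩ := hH _ a
    obtain ⟨B, _, y, b', rfl⟩ := hH _ b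
    -- Stage `k` is late enough that support points with equal image in the colimit have merged, and
    -- it is inhabited if the colimit is, so that `r` has a default value even when the supports are
    -- empty.
    have hk : ∃ (k : J) (f : j ⟶ k), (∀ p q : A ⊕ B,
        c.ι.app j (Sum.elim x y p) = c.ι.app j (Sum.elim x y q) →
          K.map f (Sum.elim x y p) = K.map f (Sum.elim x y q)) ∧
        (Nonempty c.pt → Nonempty (K.obj k)) := by
      obtain ⟨k, f, hf⟩ := exists_map_eq_of_finite hc
        (A := { p : (A ⊕ B) × (A ⊕ B) //
          c.ι.app j (Sum.elim x y p.1) = c.ι.app j (Sum.elim x y p.2) })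
        (fun p => Sum.elim x y p.1.1) (fun p => Sum.elim x y p.1.2) fun p => p.2
      rcases isEmpty_or_nonempty c.pt with hE | ⟨⟨z⟩⟩
      · exact ⟨k, f, fun p q h => hf ⟨(p, q), h⟩, fun h => (hE.false h.some).elim⟩
      · obtain ⟨l, w, -⟩ := Types.jointly_surjective_of_isColimit hc z
        refine ⟨_, f ≫ IsFiltered.leftToMax k l, fun p q h => ?_,
          fun _ => ⟨K.map (IsFiltered.rightToMax k l) w⟩⟩
        rw [K.map_comp]
        exact congrArg (K.map (IsFiltered.leftToMax k l)) (hf ⟨(p, q), h⟩)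
    obtain ⟨k, f, hf, hne⟩ := hk
    have hr : ∃ r : c.pt → K.obj k, ∀ p : A ⊕ B,
        r (c.ι.app j (Sum.elim x y p)) = K.map f (Sum.elim x y p) := by
      classical
      rcases isEmpty_or_nonempty c.pt with hE | hN
      · exact ⟨fun z => (hE.false z).elim, fun p => (hE.false (c.ι.app j (Sum.elim x y p))).elim⟩
      · obtain ⟨w⟩ := hne hN
        refine ⟨fun z => if h : ∃ p : A ⊕ B, c.ι.app j (Sum.elim x y p) = z then
          K.map f (Sum.elim x y h.choose) else w, fun p => ?_⟩
        have h : ∃ q : A ⊕ B, c.ι.app j (Sum.elim x y q) = c.ι.app j (Sum.elim x y p) := ⟨p, rfl⟩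
        exact (dif_pos h).trans (hf _ _ h.choose_spec)
    obtain ⟨r, hr⟩ := hr
    refine ⟨k, f, ?_⟩
    have ex : x ≫ K.map f = x ≫ c.ι.app j ≫ TypeCat.ofHom r := by
      ext p
      exact (hr (Sum.inl p)).symm
    have ey : y ≫ K.map f = y ≫ c.ι.app j ≫ TypeCat.ofHom r := by
      ext p
      exact (hr (Sum.inr p)).symm
    have := congrArg (H.map (TypeCat.ofHom r)) hab
    simp only [← ConcreteCategory.comp_apply, ← H.map_comp, Category.assoc] at this ⊢
    rw [ex, ey]
    exact this
  refine Types.FilteredColimit.isColimitOf _ _ (fun t => ?_) fun i j a b hab => ?_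
  · obtain ⟨A, _, x, a, rfl⟩ := hH _ t
    obtain ⟨j, y, hy⟩ := exists_lift_of_finite hc x
    refine ⟨j, H.map (TypeCat.ofHom y) a, ?_⟩
    have : x = TypeCat.ofHom y ≫ c.ι.app j := by
      ext p
      exact (hy p).symm
    rw [this, H.map_comp]
    rfl
  · let p := IsFiltered.leftToMax i j
    let q := IsFiltered.rightToMax i j
    have hp : ∀ a, H.map (c.ι.app _) (H.map (K.map p) a) = H.map (c.ι.app i) a := fun a => by
      rw [← c.w p, H.map_comp]
      rfl
    have hq : ∀ b, H.map (c.ι.app _) (H.map (K.map q) b) = H.map (c.ι.app j) b := fun b => by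
      rw [← c.w q, H.map_comp]
      rfl
    obtain ⟨k, f, hf⟩ := inj _ (H.map (K.map p) a) (H.map (K.map q) b)
      ((hp a).trans (hab.trans (hq b).symm))
    refine ⟨k, p ≫ f, q ≫ f, ?_⟩
    simp only [Functor.comp_map, K.map_comp, H.map_comp]
    exact hf

/-- The centre of a finitely supported monad is finitely supported. -/
theorem FinitelySupported.centre {T Z : Monad (Type u)} (hT : FinitelySupported T.toFunctor)
    {σ : Strength Z} {ι : Z ⟶ T} (h : (setStrength T).IsCentre σ ι) :
    FinitelySupported Z.toFunctor := by
  intro X z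
  have inj := Monad.injective_of_isTerminalCentralCone (h.terminal X)
  rcases isEmpty_or_nonempty X with hE | ⟨⟨x₀⟩⟩
  · exact ⟨X, inferInstance, 𝟙 X, z, congrArg (fun f => f z) (Z.map_id X)⟩
  obtain ⟨A, _, i, a, ha⟩ := hT X (ι.app X z)
  -- The point `x₀` keeps `B` inhabited when the support is empty, so that a retraction of `X` onto
  -- `B` exists.
  let B : Type u := Set.insert x₀ (Set.range i)
  have hB : Finite B := ((Set.finite_range i).insert x₀).to_subtype
  let m : B ⟶ X := TypeCat.ofHom Subtype.val
  let i' : A ⟶ B := TypeCat.ofHom fun a => ⟨i a, Or.inr ⟨a, rfl⟩⟩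
  classical
  let r : X ⟶ B := TypeCat.ofHom fun x =>
    if hx : x ∈ Set.insert x₀ (Set.range i) then ⟨x, hx⟩ else ⟨x₀, Or.inl rfl⟩
  have hmr : m ≫ r = 𝟙 B := by
    ext b
    exact congrArg Subtype.val (dif_pos b.2)
  have hi : i = i' ≫ m := rfl
  have key : T.map m (T.map r (ι.app X z)) = ι.app X z := by
    rw [← ha, hi]
    simp only [← ConcreteCategory.comp_apply, ← T.map_comp, Category.assoc]
    rw [reassoc_of% hmr]
  -- The support in `T` need not consist of an element of `Z`, but pushing `z` forward along `r`
  -- stays in `Z`; by `key`, `m` recovers `z` after the injective `ι`.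
  refine ⟨B, hB, m, Z.map r z, inj ?_⟩
  have n₁ := NatTrans.naturality_apply ι.toNatTrans m (Z.map r z)
  have n₂ := NatTrans.naturality_apply ι.toNatTrans r z
  exact n₁.trans ((congrArg (T.map m) n₂).trans key)

end Finitary

/-! ## Models of a Lawvere theory as algebras -/

namespace LawvereTheory

variable {T : LawvereTheory.{u}}

theorem proj_self (i : Fin 1) : proj i = T.id 1 := by
  rw [proj, ← T.base_id]
  exact congrArg T.base (funext fun _ => Subsingleton.elim _ _)

/-! ### Finite products in a theory and their preservation. -/

section Products

/-- The projection from `A ^ (∑ i, k i)` to `A ^ k i`. -/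
def sumProj {n : ℕ} (k : Fin n → ℕ) (i : Fin n) : T.Hom (∑ i, k i) (k i) :=
  T.base fun j => finSigmaFinEquiv ⟨i, j⟩

theorem sumProj_proj {n : ℕ} (k : Fin n → ℕ) (i : Fin n) (j : Fin (k i)) :
    T.comp (sumProj k i) (proj j) = proj (finSigmaFinEquiv ⟨i, j⟩) :=
  base_proj _ _

variable {n : ℕ} (K : Discrete (Fin n) ⥤ T.Obj)

/-- The cone which exhibits `A ^ (∑ i, k i)` as the product of the `A ^ k i`. -/
def sumCone : Cone K where
  pt := ⟨∑ i, (K.obj ⟨i⟩).arity⟩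
  π := Discrete.natTrans fun i => sumProj (fun i => (K.obj ⟨i⟩).arity) i.as

/-- The cone `sumCone` is a limit cone. -/
noncomputable def isLimitSumCone : IsLimit (sumCone K) where
  lift s := tuple fun r => T.comp (s.π.app ⟨(finSigmaFinEquiv.symm r).1⟩)
    (proj (finSigmaFinEquiv.symm r).2)
  fac s := by
    rintro ⟨i⟩
    refine hom_ext fun j => (T.assoc _ _ _).trans ?_
    refine (congrArg (T.comp _) (sumProj_proj (fun i => (K.obj ⟨i⟩).arity) i j)).trans ?_
    refine (tuple_proj _ _).trans ?_
    rw [Equiv.symm_apply_apply]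
  uniq s m h := by
    refine hom_ext fun r => ?_
    obtain ⟨⟨i, j⟩, rfl⟩ := finSigmaFinEquiv.surjective r
    refine Eq.trans ?_ (tuple_proj _ _).symm
    rw [Equiv.symm_apply_apply]
    refine (congrArg (T.comp m) (sumProj_proj (fun i => (K.obj ⟨i⟩).arity) i j).symm).trans ?_
    exact (T.assoc _ _ _).symm.trans (congrArg (fun f => T.comp f (proj j)) (h ⟨i⟩))

end Products

/-- The components of an element of the value at `A ^ n` of a functor. -/
def coords (M : T.Obj ⥤ Type u) (n : ℕ) (x : M.obj ⟨n⟩) (i : Fin n) : M.obj ⟨1⟩ :=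
  M.map (X := ⟨n⟩) (Y := ⟨1⟩) (proj i) x

theorem coords_map (M : T.Obj ⥤ Type u) {m n : ℕ} (f : T.Hom m n) (x : M.obj ⟨m⟩) (i : Fin n) :
    coords M n (M.map (X := ⟨m⟩) (Y := ⟨n⟩) f x) i =
      M.map (X := ⟨m⟩) (Y := ⟨1⟩) (T.comp f (proj i)) x :=
  (Functor.map_comp_apply M (X := ⟨m⟩) (Y := ⟨n⟩) (Z := ⟨1⟩) f (proj i) x).symm

/-- The product of the `A ^ k i` is `A ^ (∑ i, k i)`, and on both sides elements amount to families
of coordinates indexed by the pairs `(i, j)`. -/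
theorem preservesFiniteProducts_of_bijective (M : T.Obj ⥤ Type u)
    (h : ∀ n, Function.Bijective (coords M n)) : PreservesFiniteProducts M := by
  refine ⟨fun n => ⟨fun {K} => preservesLimit_of_preserves_limit_cone (isLimitSumCone K)
    (Classical.choice ?_)⟩⟩
  rw [Types.isLimit_iff]
  intro s _
  have key : ∀ (x : M.obj ⟨∑ i, (K.obj ⟨i⟩).arity⟩) (i : Fin n) (j : Fin (K.obj ⟨i⟩).arity),
      coords M _ (M.map ((sumCone K).π.app ⟨i⟩) x) j =
        coords M _ x (finSigmaFinEquiv ⟨i, j⟩) := fun x i j => by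
    refine (coords_map M _ x j).trans ?_
    exact congrArg (fun f => M.map (X := ⟨_⟩) (Y := ⟨1⟩) f x)
      (sumProj_proj (fun i => (K.obj ⟨i⟩).arity) i j)
  obtain ⟨x, hx⟩ := (h (∑ i, (K.obj ⟨i⟩).arity)).2 fun r =>
    coords M (K.obj ⟨(finSigmaFinEquiv.symm r).1⟩).arity (s ⟨(finSigmaFinEquiv.symm r).1⟩)
      (finSigmaFinEquiv.symm r).2
  have hx' : ∀ (i : Fin n) (j : Fin (K.obj ⟨i⟩).arity),
      coords M _ x (finSigmaFinEquiv ⟨i, j⟩) = coords M _ (s ⟨i⟩) j := fun i j => by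
    refine (congrFun hx _).trans ?_
    rw [Equiv.symm_apply_apply]
  refine ⟨x, ?_, fun y hy => ?_⟩
  · rintro ⟨i⟩
    refine (h _).1 (funext fun j => ?_)
    exact (key x i j).trans (hx' i j)
  · refine (h _).1 (funext fun r => ?_)
    obtain ⟨⟨i, j⟩, rfl⟩ := finSigmaFinEquiv.surjective r
    refine (key y i j).symm.trans (Eq.trans ?_ (hx' i j).symm)
    exact congrArg (fun z => coords M _ z j) (hy ⟨i⟩)

theorem bijective_coords (M : T.Obj ⥤ Type u) [PreservesFiniteProducts M] (n : ℕ) :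
    Function.Bijective (coords M n) := by
  let c : Cone ((Discrete.functor fun _ : Fin n => (⟨1⟩ : T.Obj))) :=
    { pt := ⟨n⟩
      π := Discrete.natTrans fun i => proj i.as }
  have hc : IsLimit c :=
    { lift := fun s => tuple fun i => s.π.app ⟨i⟩
      fac := fun s i => tuple_proj _ i.as
      uniq := fun s m h => hom_ext fun i => by
        have e := tuple_proj (k := s.pt.arity) (fun i => s.π.app ⟨i⟩) i
        exact (h ⟨i⟩).trans e.symm }
  have hM := (Types.isLimit_iff _).1 ⟨isLimitOfPreserves M hc⟩
  refine (Function.bijective_iff_existsUnique _).2 fun a => ?_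
  obtain ⟨x, hx, hu⟩ := hM (fun i => a i.as) (by
    rintro ⟨i⟩ ⟨j⟩ f
    obtain rfl : i = j := Discrete.eq_of_hom f
    rw [Subsingleton.elim f (𝟙 _)]
    exact congrArg (fun f => f (a i)) ((Discrete.functor _ ⋙ M).map_id _))
  exact ⟨x, funext fun i => hx ⟨i⟩, fun y hy => hu y fun i => congrFun hy i.as⟩

/-! ### Models as sets with operations. -/

namespace Model

/-- The underlying set of a model. -/
abbrev carrier (M : T.Model) : Type u := M.obj.obj ⟨1⟩

/-- The element of `M (A ^ n)` with given components. -/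
noncomputable def tuple (M : T.Model) {n : ℕ} (a : Fin n → carrier M) : M.obj.obj ⟨n⟩ :=
  haveI := M.property
  (Equiv.ofBijective _ (bijective_coords M.obj n)).symm a

theorem coords_tuple (M : T.Model) {n : ℕ} (a : Fin n → carrier M) :
    coords M.obj n (tuple M a) = a :=
  haveI := M.property
  (Equiv.ofBijective _ (bijective_coords M.obj n)).apply_symm_apply a

theorem coords_injective (M : T.Model) (n : ℕ) : Function.Injective (coords M.obj n) :=
  haveI := M.property
  (bijective_coords M.obj n).1

theorem tuple_coords (M : T.Model) {n : ℕ} (x : M.obj.obj ⟨n⟩) :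
    tuple M (coords M.obj n x) = x :=
  coords_injective M n (coords_tuple M _)

/-- The operation on the underlying set of a model given by a morphism `A ^ n → A`. -/
noncomputable def op (M : T.Model) {n : ℕ} (f : T.Hom n 1) (a : Fin n → carrier M) : carrier M :=
  M.obj.map (X := ⟨n⟩) (Y := ⟨1⟩) f (tuple M a)

theorem op_proj (M : T.Model) {n : ℕ} (i : Fin n) (a : Fin n → carrier M) :
    op M (proj i) a = a i :=
  congrFun (coords_tuple M a) i

theorem op_comp (M : T.Model) {m n : ℕ} (f : T.Hom m n) (g : T.Hom n 1)
    (a : Fin m → carrier M) :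
    op M (T.comp f g) a = op M g fun i => op M (T.comp f (proj i)) a := by
  have h : M.obj.map (X := ⟨m⟩) (Y := ⟨n⟩) f (tuple M a) =
      tuple M fun i => op M (T.comp f (proj i)) a := by
    refine coords_injective M n (funext fun i => ?_)
    rw [coords_map, coords_tuple, op]
  rw [op, op, ← h]
  exact Functor.map_comp_apply M.obj (X := ⟨m⟩) (Y := ⟨n⟩) (Z := ⟨1⟩) f g _

theorem op_act (M : T.Model) {k n n' : ℕ} (f : T.Hom n n') (g : Fin n → T.Hom k 1) (j : Fin n')
    (a : Fin k → carrier M) :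
    op M (act f g j) a = op M (T.comp f (proj j)) fun i => op M (g i) a := by
  rw [act, op_comp]
  simp only [tuple_proj]

/-- The map of underlying sets of a morphism of models. -/
def homFun {M N : T.Model} (α : M ⟶ N) (x : carrier M) : carrier N := α.hom.app ⟨1⟩ x

theorem coords_app {M N : T.Model} (α : M ⟶ N) {n : ℕ} (x : M.obj.obj ⟨n⟩) :
    coords N.obj n (α.hom.app ⟨n⟩ x) = fun i => homFun α (coords M.obj n x i) :=
  funext fun i => (NatTrans.naturality_apply α.hom (X := ⟨n⟩) (Y := ⟨1⟩) (proj i) x).symm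

theorem homFun_op {M N : T.Model} (α : M ⟶ N) {n : ℕ} (f : T.Hom n 1) (a : Fin n → carrier M) :
    homFun α (op M f a) = op N f fun i => homFun α (a i) := by
  have h : α.hom.app ⟨n⟩ (tuple M a) = tuple N fun i => homFun α (a i) := by
    refine coords_injective N n ?_
    rw [coords_app, coords_tuple, coords_tuple]
  rw [op, op, ← h]
  exact NatTrans.naturality_apply α.hom (X := ⟨n⟩) (Y := ⟨1⟩) f _

theorem hom_ext' {M N : T.Model} {α β : M ⟶ N} (h : ∀ x, homFun α x = homFun β x) : α = β := by
  refine ObjectProperty.hom_ext _ ?_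
  ext ⟨n⟩ x
  refine coords_injective N n ?_
  refine (coords_app α x).trans (Eq.trans ?_ (coords_app β x).symm)
  simp only [h]

/-- The morphism of models given by a map of underlying sets which commutes with the operations. -/
noncomputable def homMk {M N : T.Model} (h : carrier M → carrier N)
    (hh : ∀ (n : ℕ) (f : T.Hom n 1) (a : Fin n → carrier M),
      h (op M f a) = op N f fun i => h (a i)) : M ⟶ N :=
  ObjectProperty.homMk
    { app := fun X => TypeCat.ofHom fun x => tuple N fun i => h (coords M.obj X.arity x i)
      naturality := fun X Y f => by
        ext x
        refine coords_injective N _ (funext fun i => ?_)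
        refine (congrFun (coords_tuple N _) i).trans ?_
        refine Eq.trans ?_ (coords_map N.obj f _ i).symm
        refine Eq.trans ?_ (hh _ (T.comp f (proj i)) (coords M.obj X.arity x))
        refine congrArg h ((coords_map M.obj f x i).trans ?_)
        rw [op, tuple_coords] }

theorem homFun_homMk {M N : T.Model} (h : carrier M → carrier N)
    (hh : ∀ (n : ℕ) (f : T.Hom n 1) (a : Fin n → carrier M),
      h (op M f a) = op N f fun i => h (a i)) (x : carrier M) : homFun (homMk h hh) x = h x := by
  have e : ∀ (P : T.Model) (y : carrier P), coords P.obj 1 y 0 = y := fun P y => by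
    rw [coords, proj_self]
    exact congrArg (fun f => f y) (P.obj.map_id ⟨1⟩)
  refine (e N _).symm.trans ((congrFun (coords_tuple N _) 0).trans ?_)
  exact congrArg h (e M x)

end Model

/-- The model on a set with operations for the morphisms `A ^ n → A`. -/
def modelOfOps (A : Type u) (o : ∀ {n : ℕ}, T.Hom n 1 → (Fin n → A) → A)
    (o_proj : ∀ {n : ℕ} (i : Fin n) (a : Fin n → A), o (proj i) a = a i)
    (o_comp : ∀ {m n : ℕ} (f : T.Hom m n) (g : T.Hom n 1) (a : Fin m → A),
      o (T.comp f g) a = o g fun i => o (T.comp f (proj i)) a) : T.Model where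
  obj :=
    -- The underlying set of this model is `Fin 1 → A`, not `A` itself; hence the evaluations at `0`
    -- below.
    { obj := fun X => Fin X.arity → A
      map := fun {X Y} f => TypeCat.ofHom fun a j => o (T.comp f (proj j)) a
      map_id := fun X => by
        ext a
        refine Eq.trans ?_ (o_proj _ a)
        exact congrArg (fun f => o f a) (T.id_comp _)
      map_comp := fun {X Y Z} f g => by
        ext a
        refine Eq.trans ?_ (o_comp f (T.comp g (proj _)) a)
        exact congrArg (fun f => o f a) (T.assoc _ _ _) }
  property := by
    refine preservesFiniteProducts_of_bijective _ fun n => ?_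
    have e : ∀ (x : Fin n → A) (i : Fin n) (j : Fin 1),
        o (T.comp (proj i) (proj j)) x = x i := fun x i j => by
      rw [proj_self, T.comp_id, o_proj]
    refine ⟨fun x y h => funext fun i => ?_, fun a => ⟨fun i => a i 0, ?_⟩⟩
    · exact (e x i 0).symm.trans ((congrFun (congrFun h i) 0).trans (e y i 0))
    · refine funext fun i => funext fun j => (e _ i j).trans ?_
      rw [Subsingleton.elim j 0]

section ModelOfOps

variable {A : Type u} {o : ∀ {n : ℕ}, T.Hom n 1 → (Fin n → A) → A}
  {o_proj : ∀ {n : ℕ} (i : Fin n) (a : Fin n → A), o (proj i) a = a i}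
  {o_comp : ∀ {m n : ℕ} (f : T.Hom m n) (g : T.Hom n 1) (a : Fin m → A),
    o (T.comp f g) a = o g fun i => o (T.comp f (proj i)) a}

theorem modelOfOps_op {n : ℕ} (f : T.Hom n 1)
    (a : Fin n → Model.carrier (modelOfOps A o o_proj o_comp)) (j : Fin 1) :
    Model.op (modelOfOps A o o_proj o_comp) f a j = o f fun i => a i 0 := by
  have h : Model.tuple (modelOfOps A o o_proj o_comp) a = fun i => a i 0 := by
    refine Model.coords_injective _ n ((Model.coords_tuple _ a).trans ?_)
    refine funext fun i => funext fun j => ?_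
    refine Eq.trans ?_ (o_proj i fun i => a i 0).symm |>.trans ?_
    · rw [Subsingleton.elim j 0]
    · exact congrArg (fun f => o f _) ((T.comp_id _).symm.trans
        (congrArg (T.comp (proj i)) (proj_self j).symm))
  rw [Model.op, h]
  exact congrArg (fun f => o f _) ((congrArg (T.comp f) (proj_self j)).trans (T.comp_id f))

end ModelOfOps

/-! ## Free models -/

variable (T) in
/-- The terms with variables in `X` for the operations of the theory. -/
inductive Term (X : Type u) : Type u
  | var (x : X) : Term X
  | op {n : ℕ} (f : T.Hom n 1) (a : Fin n → Term X) : Term X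

/-- The value of a term in a model. -/
noncomputable def Term.eval {X : Type u} (M : T.Model) (v : X → Model.carrier M) :
    T.Term X → Model.carrier M
  | .var x => v x
  | .op f a => Model.op M f fun i => (a i).eval M v

variable (T) in
/-- Terms are identified if they have the same values in all models. -/
def termSetoid (X : Type u) : Setoid (T.Term X) where
  r s t := ∀ (M : T.Model) (v : X → Model.carrier M), s.eval M v = t.eval M v
  iseqv := ⟨fun _ _ _ => rfl, fun h M v => (h M v).symm,
    fun h h' M v => (h M v).trans (h' M v)⟩

variable (T) in
/-- The underlying set of the free model on `X`. -/
def Free (X : Type u) : Type u := Quotient (T.termSetoid X)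

namespace Free

variable {X : Type u}

/-- The generators. -/
def var (x : X) : T.Free X := Quotient.mk _ (.var x)

/-- The operations. -/
noncomputable def op {n : ℕ} (f : T.Hom n 1) (a : Fin n → T.Free X) : T.Free X :=
  Quotient.mk (T.termSetoid X) (.op f fun i => (a i).out)

/-- The value in a model of an element of the free model. -/
noncomputable def eval (M : T.Model) (v : X → Model.carrier M) (t : T.Free X) :
    Model.carrier M :=
  Quotient.lift (fun t : T.Term X => t.eval M v) (fun _ _ (h : T.termSetoid X _ _) => h M v) t

theorem eval_out (M : T.Model) (v : X → Model.carrier M) (t : T.Free X) :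
    t.out.eval M v = eval M v t := by
  conv_rhs => rw [← Quotient.out_eq t]
  rfl

theorem eval_op (M : T.Model) (v : X → Model.carrier M) {n : ℕ} (f : T.Hom n 1)
    (a : Fin n → T.Free X) : eval M v (op f a) = Model.op M f fun i => eval M v (a i) := by
  simp only [← eval_out M v (a _)]
  rfl

/-- Because the identification of terms is semantic, every law valid in all models holds in the
quotient, in particular the two required by `modelOfOps`. -/
theorem ext {s t : T.Free X}
    (h : ∀ (M : T.Model) (v : X → Model.carrier M), eval M v s = eval M v t) : s = t := by
  induction s using Quotient.ind
  induction t using Quotient.ind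
  exact Quotient.sound h

theorem op_proj {n : ℕ} (i : Fin n) (a : Fin n → T.Free X) : op (proj i) a = a i :=
  ext fun M v => by rw [eval_op, Model.op_proj]

theorem op_comp {m n : ℕ} (f : T.Hom m n) (g : T.Hom n 1) (a : Fin m → T.Free X) :
    op (T.comp f g) a = op g fun i => op (T.comp f (proj i)) a :=
  ext fun M v => by
    simp only [eval_op]
    rw [Model.op_comp]

theorem induction {P : T.Free X → Prop} (hvar : ∀ x, P (var x))
    (hop : ∀ (n : ℕ) (f : T.Hom n 1) (a : Fin n → T.Free X), (∀ i, P (a i)) → P (op f a))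
    (t : T.Free X) : P t := by
  induction t using Quotient.ind with
  | _ t =>
    induction t with
    | var x => exact hvar x
    | op f a ih =>
      -- `op` chooses representatives of its arguments, so this is not definitional; evaluation in
      -- models does not see the choice.
      have e : (Quotient.mk (T.termSetoid X) (.op f a) : T.Free X) =
          op f fun i => Quotient.mk (T.termSetoid X) (a i) :=
        ext fun M v => (eval_op M v f fun i => Quotient.mk (T.termSetoid X) (a i)).symm
      rw [e]
      exact hop _ f _ ih

end Free

variable (T) in
/-- The free model on a set. -/
noncomputable def freeModel (X : Type u) : T.Model :=
  modelOfOps (T.Free X) Free.op Free.op_proj Free.op_comp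

/-- The generators of the free model. -/
noncomputable def freeModelVar {X : Type u} (x : X) : Model.carrier (T.freeModel X) :=
  fun _ : Fin 1 => Free.var x

theorem freeModel_op {X : Type u} {n : ℕ} (f : T.Hom n 1)
    (a : Fin n → Model.carrier (T.freeModel X)) :
    Model.op (T.freeModel X) f a = fun _ : Fin 1 => Free.op f fun i => a i 0 :=
  funext fun j => modelOfOps_op (o_proj := Free.op_proj) (o_comp := Free.op_comp) f a j

theorem freeModel_induction {X : Type u} {P : Model.carrier (T.freeModel X) → Prop}
    (hvar : ∀ x, P (freeModelVar x))
    (hop : ∀ (n : ℕ) (f : T.Hom n 1) (a : Fin n → Model.carrier (T.freeModel X)),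
      (∀ i, P (a i)) → P (Model.op (T.freeModel X) f a))
    (t : Model.carrier (T.freeModel X)) : P t := by
  have h : ∀ s : T.Free X, P (fun _ : Fin 1 => s) := fun s => by
    induction s using Free.induction with
    | hvar x => exact hvar x
    | hop n f a ih =>
      have h := hop n f (fun i (_ : Fin 1) => a i) ih
      exact (freeModel_op f fun i (_ : Fin 1) => a i) ▸ h
  have e : t = fun _ : Fin 1 => t 0 := funext fun j => by rw [Subsingleton.elim j 0]
  rw [e]
  exact h _

theorem eval_freeModel_op {X : Type u} (M : T.Model) (v : X → Model.carrier M) {n : ℕ}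
    (f : T.Hom n 1) (a : Fin n → Model.carrier (T.freeModel X)) :
    Free.eval M v (Model.op (T.freeModel X) f a 0) =
      Model.op M f fun i => Free.eval M v (a i 0) := by
  rw [freeModel_op]
  exact Free.eval_op M v f _

/-- The universal property of the free model. -/
noncomputable def freeModelEquiv (X : Type u) (M : T.Model) :
    (T.freeModel X ⟶ M) ≃ (X ⟶ T.forget.obj M) where
  toFun α := TypeCat.ofHom fun x => Model.homFun α (freeModelVar x)
  invFun v := Model.homMk (M := T.freeModel X) (fun t => Free.eval M v (t 0)) fun _ =>
    eval_freeModel_op M v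
  left_inv α := Model.hom_ext' fun t => by
    rw [Model.homFun_homMk]
    induction t using freeModel_induction with
    | hvar x => rfl
    | hop n f a ih =>
      rw [Model.homFun_op, ← funext ih]
      exact eval_freeModel_op M _ f a
  right_inv v := by
    ext x
    exact Model.homFun_homMk (M := T.freeModel X) (fun t => Free.eval M v (t 0))
      (fun _ => eval_freeModel_op M v) (freeModelVar x)

variable (T) in
theorem isRightAdjoint_forget : T.forget.IsRightAdjoint :=
  (Adjunction.adjunctionOfEquivLeft (freeModelEquiv (T := T)) fun _ _ _ _ _ => rfl).isRightAdjoint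

end LawvereTheory

/-! ## The monad of a Lawvere theory -/

namespace LawvereTheory

variable {T : LawvereTheory.{u}}

/-- The exchange law for the generic matrix, whose entries are the projections of `A ^ (n * m)`, is
evaluated in `M` at the entries of `a`. -/
theorem op_comm_of_commute (M : T.Model) {n m : ℕ} {f : T.Hom n 1} {g : T.Hom m 1}
    (h : Commute f g) (a : Fin n → Fin m → Model.carrier M) :
    (Model.op M f fun i => Model.op M g (a i)) =
      Model.op M g fun j => Model.op M f fun i => a i j := by
  have e := (commute_iff f g).1 h (n * m) (fun s t => proj (finProdFinEquiv (s, t))) 0 0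
  have := congrArg (fun q => Model.op M q fun r => a (finProdFinEquiv.symm r).1
    (finProdFinEquiv.symm r).2) e
  simpa only [Model.op_act, Model.op_proj, proj_self, T.comp_id, Equiv.symm_apply_apply]
    using this

variable (T) in
/-- The model represented by `A ^ n`. -/
def representable (n : ℕ) : T.Model where
  obj := coyoneda.obj (Opposite.op ⟨n⟩)
  property := inferInstance

theorem representable_op {n k : ℕ} (f : T.Hom k 1) (a : Fin k → T.Hom n 1) :
    Model.op (T.representable n) f a = act f a 0 := by
  have h : Model.tuple (T.representable n) a = tuple a :=
    Model.coords_injective _ k ((Model.coords_tuple (T.representable n) a).trans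
      (funext fun i => (tuple_proj a i).symm))
  refine (congrArg (fun x =>
    (T.representable n).obj.map (X := ⟨k⟩) (Y := ⟨1⟩) f x) h).trans ?_
  rw [act, proj_self, T.comp_id]
  rfl

/-! ### The monad of an arbitrary left adjoint of the forgetful functor. -/

section FreeMonad

variable {F : Type u ⥤ T.Model} (adj : F ⊣ T.forget)

/-- The generators of a free model. -/
def gen {X : Type u} (x : X) : Model.carrier (F.obj X) := adj.toMonad.ret x

/-- The map from a free model given by the values on the generators. -/
def extend {X : Type u} (M : T.Model) (h : X → Model.carrier M) : F.obj X ⟶ M :=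
  (adj.homEquiv X M).symm (TypeCat.ofHom h)

theorem extend_gen {X : Type u} (M : T.Model) (h : X → Model.carrier M) (x : X) :
    Model.homFun (extend adj M h) (gen adj x) = h x := by
  have := (adj.homEquiv_unit X M (extend adj M h)).symm.trans
    ((adj.homEquiv X M).apply_symm_apply (TypeCat.ofHom h))
  exact congrArg (fun f => f x) this

theorem bind_gen {X Y : Type u} (x : X) (h : X → Model.carrier (F.obj Y)) :
    adj.toMonad.bind (gen adj x) h = h x :=
  Monad.ret_bind (T := adj.toMonad) x h

/-- Kleisli extension underlies a morphism of models, namely `F.map` followed by the counit. -/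
theorem bind_op {X Y : Type u} {n : ℕ} (f : T.Hom n 1) (a : Fin n → Model.carrier (F.obj X))
    (h : X → Model.carrier (F.obj Y)) :
    adj.toMonad.bind (Model.op (F.obj X) f a) h =
      Model.op (F.obj Y) f fun i => adj.toMonad.bind (a i) h :=
  Model.homFun_op (F.map (TypeCat.ofHom h) ≫ adj.counit.app (F.obj Y)) f a

theorem map_op {X Y : Type u} {n : ℕ} (i : X ⟶ Y) (f : T.Hom n 1)
    (a : Fin n → Model.carrier (F.obj X)) :
    adj.toMonad.map i (Model.op (F.obj X) f a) =
      Model.op (F.obj Y) f fun j => adj.toMonad.map i (a j) :=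
  Model.homFun_op (F.map i) f a

theorem map_gen {X Y : Type u} (i : X ⟶ Y) (x : X) :
    adj.toMonad.map i (gen adj x) = gen adj (i x) :=
  (NatTrans.naturality_apply adj.toMonad.η i x).symm

/-- `F.obj X` is a retract of the term model: `β ≫ α` fixes the generators, so it is the identity,
and induction on terms transfers along `α`. -/
theorem free_induction {X : Type u} {P : Model.carrier (F.obj X) → Prop}
    (hgen : ∀ x, P (gen adj x))
    (hop : ∀ (n : ℕ) (f : T.Hom n 1) (a : Fin n → Model.carrier (F.obj X)),
      (∀ i, P (a i)) → P (Model.op (F.obj X) f a))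
    (t : Model.carrier (F.obj X)) : P t := by
  let β : F.obj X ⟶ T.freeModel X := extend adj _ freeModelVar
  let α : T.freeModel X ⟶ F.obj X := (freeModelEquiv X _).symm (TypeCat.ofHom (gen adj))
  have hα : ∀ x, Model.homFun α (freeModelVar x) = gen adj x := fun x =>
    congrArg (fun f => f x) ((freeModelEquiv X (F.obj X)).apply_symm_apply _)
  have hβα : β ≫ α = 𝟙 _ := by
    refine (adj.homEquiv _ _).injective ?_
    ext x
    have h₁ : ((adj.homEquiv _ _) (β ≫ α)) x = Model.homFun α (Model.homFun β (gen adj x)) :=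
      congrArg (fun f => f x) (adj.homEquiv_unit X _ (β ≫ α))
    have h₂ : ((adj.homEquiv _ _) (𝟙 (F.obj X))) x = gen adj x :=
      congrArg (fun f => f x) (adj.homEquiv_id X)
    exact h₁.trans ((congrArg _ (extend_gen adj _ _ x)).trans ((hα x).trans h₂.symm))
  have key : ∀ s, P (Model.homFun α s) := fun s => by
    induction s using freeModel_induction with
    | hvar x => rw [hα]; exact hgen x
    | hop n f a ih =>
      rw [Model.homFun_op]
      exact hop n f _ ih
  have e : Model.homFun α (Model.homFun β t) = t :=
    congrArg (fun γ : F.obj X ⟶ F.obj X => Model.homFun γ t) hβα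
  exact e ▸ key _

theorem finitelySupported_toMonad : FinitelySupported adj.toMonad.toFunctor := by
  intro X t
  induction t using free_induction adj with
  | hgen x =>
    exact ⟨PUnit, inferInstance, TypeCat.ofHom fun _ => x, gen adj PUnit.unit, map_gen adj _ _⟩
  | hop n f a ih =>
    choose A hA i b hb using ih
    -- The disjoint union of the supports of the finitely many arguments supports the result.
    refine ⟨Σ j, A j, inferInstance, TypeCat.ofHom fun p => i p.1 p.2,
      Model.op (F.obj _) f fun j => adj.toMonad.map (TypeCat.ofHom fun p => ⟨j, p⟩) (b j), ?_⟩
    refine (map_op adj _ f _).trans (congrArg _ (funext fun j => ?_))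
    refine Eq.trans ?_ (hb j)
    exact (Functor.map_comp_apply adj.toMonad.toFunctor _ _ (b j)).symm

/-- The morphism `A ^ n → A` given by an element of the free model on `n` generators. -/
def toHom {n : ℕ} (t : Model.carrier (F.obj (ULift.{u} (Fin n)))) : T.Hom n 1 :=
  Model.homFun (extend adj (T.representable n) fun i => proj i.down) t

/-- The element of the free model on `n` generators given by a morphism `A ^ n → A`. -/
noncomputable def ofHom {n : ℕ} (f : T.Hom n 1) : Model.carrier (F.obj (ULift.{u} (Fin n))) :=
  Model.op (F.obj _) f fun i => gen adj ⟨i⟩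

theorem toHom_gen {n : ℕ} (i : ULift.{u} (Fin n)) : toHom adj (gen adj i) = proj i.down :=
  extend_gen adj _ _ i

theorem toHom_op {n k : ℕ} (f : T.Hom k 1)
    (a : Fin k → Model.carrier (F.obj (ULift.{u} (Fin n)))) :
    toHom adj (Model.op (F.obj _) f a) = act f (fun i => toHom adj (a i)) 0 :=
  (Model.homFun_op _ f a).trans (representable_op f _)

theorem toHom_ofHom {n : ℕ} (f : T.Hom n 1) : toHom adj (ofHom adj f) = f := by
  rw [ofHom, toHom_op]
  simp only [toHom_gen]
  rw [act, proj_self, T.comp_id]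
  have : tuple (fun i : Fin n => proj i) = T.id n := hom_ext fun i => by
    rw [tuple_proj, T.id_comp]
  rw [this, T.id_comp]

theorem ofHom_toHom {n : ℕ} (t : Model.carrier (F.obj (ULift.{u} (Fin n)))) :
    ofHom adj (toHom adj t) = t := by
  induction t using free_induction adj with
  | hgen i => rw [toHom_gen, ofHom, Model.op_proj]
  | hop k f a ih =>
    rw [toHom_op, ofHom, Model.op_act, proj_self, T.comp_id]
    exact congrArg _ (funext ih)

theorem bind_ofHom {n : ℕ} {X : Type u} (f : T.Hom n 1)
    (h : ULift.{u} (Fin n) → Model.carrier (F.obj X)) :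
    adj.toMonad.bind (ofHom adj f) h = Model.op (F.obj X) f fun i => h ⟨i⟩ := by
  rw [ofHom, bind_op]
  simp only [bind_gen]
  rfl

theorem toHom_bind {m n : ℕ} (t : Model.carrier (F.obj (ULift.{u} (Fin n))))
    (h : ULift.{u} (Fin n) → Model.carrier (F.obj (ULift.{u} (Fin m)))) :
    toHom adj (adj.toMonad.bind t h) =
      T.comp (tuple fun i => toHom adj (h ⟨i⟩)) (toHom adj t) := by
  conv_lhs => rw [← ofHom_toHom adj t]
  rw [bind_ofHom, toHom_op, act, proj_self, T.comp_id]

/-- A finite support is relabelled by `Fin n`, and an element of the free model on `n` generators is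
a single operation by `ofHom_toHom`. -/
theorem exists_eq_op_gen {X : Type u} (t : Model.carrier (F.obj X)) :
    ∃ (n : ℕ) (f : T.Hom n 1) (x : Fin n → X),
      t = Model.op (F.obj X) f fun i => gen adj (x i) := by
  obtain ⟨A, _, i, a, rfl⟩ := finitelySupported_toMonad adj X t
  obtain ⟨n, ⟨e⟩⟩ := Finite.exists_equiv_fin A
  let p : A ⟶ ULift.{u} (Fin n) := TypeCat.ofHom fun a => ⟨e a⟩
  let q : ULift.{u} (Fin n) ⟶ A := TypeCat.ofHom fun j => e.symm j.down
  have hpq : p ≫ q = 𝟙 A := by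
    ext a
    exact e.symm_apply_apply a
  have ha : adj.toMonad.map q (adj.toMonad.map p a) = a := by
    rw [← ConcreteCategory.comp_apply, ← Functor.map_comp, hpq, CategoryTheory.Functor.map_id]
    rfl
  refine ⟨n, toHom adj (adj.toMonad.map p a), fun j => i (e.symm j), ?_⟩
  have h : adj.toMonad.map q (ofHom adj (toHom adj (adj.toMonad.map p a))) = a :=
    (congrArg _ (ofHom_toHom adj _)).trans ha
  conv_lhs => rw [← h]
  rw [ofHom]
  refine (congrArg _ (map_op adj q _ _)).trans ((map_op adj i _ _).trans ?_)
  refine congrArg _ (funext fun j => ?_)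
  exact (congrArg _ (map_gen adj q _)).trans (map_gen adj i _)

/-- With `s` written as `g` applied to generators `y j`, the claim is the exchange of `f` and `g` on
the matrix of generators `(x i, y j)`. -/
theorem isCentralElement_op_gen {X : Type u} {n : ℕ} {f : T.Hom n 1} (hf : IsCentral f)
    (x : Fin n → X) :
    Monad.IsCentralElement (T := adj.toMonad) (Model.op (F.obj X) f fun i => gen adj (x i)) := by
  intro Y s
  obtain ⟨m, g, y, rfl⟩ := exists_eq_op_gen adj s
  have h := op_comm_of_commute (F.obj (X × Y)) (hf m 1 g) fun i j => gen adj (x i, y j)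
  refine Eq.trans ?_ (h.symm.trans ?_)
  · refine (bind_op adj g _ _).trans (congrArg _ (funext fun j => ?_))
    refine (bind_gen adj _ _).trans ((bind_op adj f _ _).trans (congrArg _ (funext fun i => ?_)))
    exact bind_gen adj _ _
  · refine ((bind_op adj f _ _).trans (congrArg _ (funext fun i => ?_))).symm
    refine (bind_gen adj _ _).trans ((bind_op adj g _ _).trans (congrArg _ (funext fun j => ?_)))
    exact bind_gen adj _ _

/-- By `commute_iff`, commutation is tested on matrices of morphisms `A ^ k → A`. These are elements
of the free model on `k` generators, where the exchange is `bind_comm`. -/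
theorem isCentral_toHom {n : ℕ} {t : Model.carrier (F.obj (ULift.{u} (Fin n)))}
    (ht : Monad.IsCentralElement (T := adj.toMonad) t) : IsCentral (toHom adj t) := by
  intro m m' g
  rw [commute_iff]
  intro k a j i
  obtain rfl := Subsingleton.elim 0 j
  have h := ht.bind_comm (ofHom adj (T.comp g (proj i)))
    (fun p q => ofHom adj (a p.down q.down))
  have e := congrArg (toHom adj) h
  -- With `t` in the form `ofHom _`, `bind_ofHom` turns both extensions into operations.
  rw [← ofHom_toHom adj t] at e
  simp only [bind_ofHom, toHom_op, toHom_ofHom, act_comp_proj] at e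
  exact e.symm

/-- The morphism from the theory of the monad of a Lawvere theory to the theory. -/
noncomputable def ofKleisliTheory : Morphism (kleisliTheory adj.toMonad) T where
  map {m n} (f : kleisliFin adj.toMonad n ⟶ kleisliFin adj.toMonad m) :=
    tuple fun j => toHom adj (f.of ⟨j⟩)
  map_id n := hom_ext fun i => by
    rw [tuple_proj, T.id_comp]
    exact toHom_gen adj ⟨i⟩
  map_comp f g := hom_ext fun i => by
    rw [tuple_proj, T.assoc, tuple_proj]
    exact toHom_bind adj _ _
  map_base w := hom_ext fun i => by
    rw [tuple_proj, base_proj]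
    exact toHom_gen adj ⟨w i⟩

theorem isEquiv_ofKleisliTheory : (ofKleisliTheory adj).IsEquiv := fun m n => by
  refine ⟨fun (f : kleisliFin adj.toMonad n ⟶ kleisliFin adj.toMonad m)
    (g : kleisliFin adj.toMonad n ⟶ kleisliFin adj.toMonad m) h => Kleisli.hom_ext ?_,
    fun g => ⟨Kleisli.Hom.mk (TypeCat.ofHom fun j => ofHom adj (T.comp g (proj j.down))), ?_⟩⟩
  · ext j
    have e := congrArg (fun q => T.comp q (proj j.down)) h
    have e' := (tuple_proj _ _).symm.trans (e.trans (tuple_proj _ _))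
    exact (ofHom_toHom adj _).symm.trans ((congrArg (ofHom adj) e').trans (ofHom_toHom adj _))
  · refine hom_ext fun i => (tuple_proj _ _).trans ?_
    exact toHom_ofHom adj _

/-! ### Comparison of the two centres. -/

section Centre

variable {Z : Monad (Type u)} {σ : Strength Z} {ι : Z ⟶ adj.toMonad}

theorem isCentral_ofKleisliTheory_map (h : (setStrength adj.toMonad).IsCentre σ ι) {m n : ℕ} (f : (kleisliTheory Z).Hom m n) :
    IsCentral ((ofKleisliTheory adj).map ((kleisliTheoryMap ι).map f)) :=
  isCentral_of_proj fun i => by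
    have e : T.comp ((ofKleisliTheory adj).map ((kleisliTheoryMap ι).map f)) (proj i) = _ :=
      tuple_proj _ i
    rw [e]
    exact isCentral_toHom adj
      ((Monad.isCentralElement_iff_mem_range (h.terminal _) _).2 ⟨_, rfl⟩)

/-- The morphism from the theory of the centre of the monad to the centre of the theory. -/
noncomputable def toCentre (h : (setStrength adj.toMonad).IsCentre σ ι) : Morphism (kleisliTheory Z) T.centre where
  map f := ⟨(ofKleisliTheory adj).map ((kleisliTheoryMap ι).map f),
    isCentral_ofKleisliTheory_map adj h f⟩
  map_id n := Subtype.ext <|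
    (congrArg (ofKleisliTheory adj).map ((kleisliTheoryMap ι).map_id n)).trans
      ((ofKleisliTheory adj).map_id n)
  map_comp f g := Subtype.ext <|
    (congrArg (ofKleisliTheory adj).map ((kleisliTheoryMap ι).map_comp f g)).trans
      ((ofKleisliTheory adj).map_comp _ _)
  map_base w := Subtype.ext <|
    (congrArg (ofKleisliTheory adj).map ((kleisliTheoryMap ι).map_base w)).trans
      ((ofKleisliTheory adj).map_base w)

theorem isEquiv_toCentre (h : (setStrength adj.toMonad).IsCentre σ ι) :
    (toCentre adj h).IsEquiv := fun m n => by
  refine ⟨fun (f : kleisliFin Z n ⟶ kleisliFin Z m) (g : kleisliFin Z n ⟶ kleisliFin Z m) hfg =>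
    Kleisli.hom_ext ?_, fun g => ?_⟩
  · have e : (kleisliTheoryMap ι).map f = (kleisliTheoryMap ι).map g :=
      (isEquiv_ofKleisliTheory adj m n).1 (congrArg Subtype.val hfg)
    have e' : f.of ≫ ι.app _ = g.of ≫ ι.app _ := congrArg Kleisli.Hom.of e
    have := (h.terminal (kleisliFin Z m).of).mono
    exact (cancel_mono _).1 e'
  -- Fullness: the components of a central morphism are central, so they give central elements,
  -- which lie in the range of `ι`.
  · have hz : ∀ j : ULift.{u} (Fin n), ∃ z : Z.obj (ULift.{u} (Fin m)),
        ι.app (ULift.{u} (Fin m)) z = ofHom adj (T.comp g.1 (proj j.down)) := fun j => by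
      have hj : IsCentral (T.comp g.1 (proj j.down)) := g.2.comp (isCentral_base _)
      exact (Monad.isCentralElement_iff_mem_range (h.terminal (ULift.{u} (Fin m)))
        (ofHom adj (T.comp g.1 (proj j.down)))).1
          (isCentralElement_op_gen adj hj fun i : Fin m => ULift.up i)
    choose z hz using hz
    refine ⟨Kleisli.Hom.mk (TypeCat.ofHom z), Subtype.ext (hom_ext fun i => ?_)⟩
    refine (tuple_proj _ _).trans ?_
    exact (congrArg (toHom adj) (hz ⟨i⟩)).trans (toHom_ofHom adj _)

end Centre

end FreeMonad

/-! ## The category of finite Kleisli objects -/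

/-- The functor given by a morphism of Lawvere theories. -/
def Morphism.toFunctor {S T : LawvereTheory.{u}} (φ : Morphism S T) : S.Obj ⥤ T.Obj where
  obj X := ⟨X.arity⟩
  map f := φ.map f
  map_id X := φ.map_id X.arity
  map_comp f g := φ.map_comp f g

theorem Morphism.IsEquiv.isEquivalence {S T : LawvereTheory.{u}} {φ : Morphism S T}
    (h : φ.IsEquiv) : φ.toFunctor.IsEquivalence where
  faithful := ⟨fun {X Y} _ _ e => (h X.arity Y.arity).1 e⟩
  full := ⟨fun {X Y} f => (h X.arity Y.arity).2 f⟩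
  essSurj := ⟨fun Y => ⟨⟨Y.arity⟩, ⟨Iso.refl _⟩⟩⟩

/-- The inclusion of the theory of a monad into the opposite of the category of the finite
Kleisli objects. -/
def kleisliTheoryToFinite (Z : Monad (Type u)) : (kleisliTheory Z).Obj ⥤ (FiniteKleisli Z)ᵒᵖ where
  obj X := Opposite.op ⟨kleisliFin Z X.arity, inferInstanceAs (Finite (ULift (Fin X.arity)))⟩
  map f := Quiver.Hom.op (ObjectProperty.homMk f)
  map_id _ := rfl
  map_comp _ _ := rfl

instance (Z : Monad (Type u)) : (kleisliTheoryToFinite Z).IsEquivalence where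
  faithful := ⟨fun e => congrArg (fun q => q.unop.hom) e⟩
  full := ⟨fun f => ⟨f.unop.hom, rfl⟩⟩
  essSurj := ⟨fun Y => by
    have : Finite Y.unop.obj.of := Y.unop.property
    obtain ⟨n, ⟨e⟩⟩ := Finite.exists_equiv_fin Y.unop.obj.of
    have i : Y.unop.obj.of ≅ ULift.{u} (Fin n) := (e.trans Equiv.ulift.symm).toIso
    have k : Y.unop.obj ≅ kleisliFin Z n := (Kleisli.Adjunction.toKleisli Z).mapIso i
    exact ⟨⟨n⟩, ⟨Iso.op (ObjectProperty.isoMk _ k)⟩⟩⟩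

theorem Morphism.IsEquiv.nonempty_skeleton_equivalence {Z : Monad (Type u)}
    {S : LawvereTheory.{u}} {e : Morphism (kleisliTheory Z) S} (h : e.IsEquiv) :
    Nonempty ((Skeleton (FiniteKleisli Z))ᵒᵖ ≌ S.Obj) := by
  have := h.isEquivalence
  exact ⟨(skeletonEquivalence _).op.trans
    ((kleisliTheoryToFinite Z).asEquivalence.symm.trans e.toFunctor.asEquivalence)⟩

end LawvereTheory

theorem mainTheorem12 (T : LawvereTheory.{u}) :
    T.forget.IsRightAdjoint ∧
    ∀ (F : Type u ⥤ T.Model) (adj : F ⊣ T.forget),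
      (setStrength adj.toMonad).IsCentralisable ∧
      (∃ (Z : Monad (Type u)) (σ : Strength Z) (ι : Z ⟶ adj.toMonad),
        (setStrength adj.toMonad).IsCentre σ ι) ∧
      ∀ (Z : Monad (Type u)) (σ : Strength Z) (ι : Z ⟶ adj.toMonad),
        (setStrength adj.toMonad).IsCentre σ ι →
        σ.IsCommutative ∧
        PreservesFilteredColimits Z.toFunctor ∧
        Nonempty ((Skeleton (FiniteKleisli Z))ᵒᵖ ≌ T.centre.Obj) ∧
        ∃ (φ : LawvereTheory.Morphism (kleisliTheory adj.toMonad) T)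
          (e : LawvereTheory.Morphism (kleisliTheory Z) T.centre),
          φ.IsEquiv ∧ e.IsEquiv ∧
          ∀ (m n : ℕ) (f : (kleisliTheory Z).Hom m n),
            T.centreInclusion.map (e.map f) = φ.map ((kleisliTheoryMap ι).map f) := by
  refine ⟨T.isRightAdjoint_forget, fun F adj => ⟨fun X => ⟨_, _,
    adj.toMonad.isCentre_centralElements.terminal X⟩,
    ⟨_, _, _, adj.toMonad.isCentre_centralElements⟩, fun Z σ ι h => ⟨h.isCommutative,
    ((LawvereTheory.finitelySupported_toMonad adj).centre h).preservesFilteredColimits,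
    (LawvereTheory.isEquiv_toCentre adj h).nonempty_skeleton_equivalence,
    LawvereTheory.ofKleisliTheory adj, LawvereTheory.toCentre adj h,
    LawvereTheory.isEquiv_ofKleisliTheory adj, LawvereTheory.isEquiv_toCentre adj h,
    fun _ _ _ => rfl⟩⟩⟩
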